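/- **Theorem 2.1.** Let $X$ be a centered Gaussian random vector on a probability space with values in a real separable Hilbert space $H$, let $P$ be its law, and assume that the covariance operator of $P$ has infinitely many nonzero eigenvalues $\lambda_1\ge\lambda_2\ge\dots>0$ (ordered, repeated according to multiplicity). Let $(u_j)_{j\ge1}$ be a corresponding orthonormal basis of $\operatorname{supp}(P)$ consisting of eigenvectors. Write $a_n\sim b_n$ for $a_n/b_n\to1$ as $n\to\infty$. For a probability measure $Q$ with finite second moment on a Hilbert space $E$ and $n\ge1$, let $$e_n(Q)=\inf\Big\{\Big(\int\min_{a\in\alpha}\|x-a\|^2\,dQ(x)\Big)^{1/2}:\alpha\subset E,\ 1\le|\alpha|\le n\Big\},\qquad e_n:=e_n(P),$$ and call a Borel measurable map $g:E\to E$ with $|g(E)|\le n$ an $n$-optimal quantizer for $Q$ if $\big(\int\|x-g(x)\|^2\,dQ(x)\big)^{1/2}=e_n(Q)$. For $n\ge1$ put $$m=m(n):=\max\Big\{k\ge1:\ n^{1/k}\lambda_k^{1/2}\Big(\prod_{j=1}^k\lambda_j\Big)^{-1/(2k)}\ge1\Big\},\qquad n_j:=\Big\lfloor n^{1/m}\lambda_j^{1/2}\Big(\prod_{i=1}^m\lambda_i\Big)^{-1/(2m)}\Big\rfloor\quad(1\le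 j\le m),$$ let $g_j=g_{j,n}:\mathbb R\to\mathbb R$ be any $n_j$-optimal quantizers for $\mathcal N(0,1)$, $1\le j\le m$, and define the scalar product quantizer $$f_n^{(1)}(x):=\sum_{j=1}^{m(n)}\lambda_j^{1/2}\,g_j\big(\langle x,u_j\rangle/\lambda_j^{1/2}\big)\,u_j,\qquad x\in H.$$ Suppose that $\lambda_j\sim\varphi(j)$ as $j\to\infty$, where, for some $s\ge0$, $\varphi:(s,\infty)\to(0,\infty)$ is a decreasing (i.e. nonincreasing) function that is regularly varying at infinity with index $-1$, i.e. $\varphi$ is measurable and $\lim_{x\to\infty}\varphi(tx)/\varphi(x)=t^{-1}$ for every $t>0$. For $x>s$ put $\psi(x):=1/\int_x^\infty\varphi(y)\,dy$. Then, as $n\to\infty$, $$e_n\sim\big(E\|X-f_n^{(1)}(X)\|^2\big)^{1/2}\sim\psi(\log n)^{-1/2}\qquad\text{and}\qquad m(n)\sim2\log n.$$ In particular $\lim_{n\to\infty}e_n^2/E\|X-f_n^{(1)}(X)\|^2=1$, i.e. scalar product quantization is asymptotically optimal. -/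

import Mathlib

open MeasureTheory ProbabilityTheory Filter Topology Asymptotics
open scoped RealInnerProductSpace

/-- The minimal `n`-th (quadratic) quantization error
`e_n(P) = inf {(E min_{a ∈ α} ‖X - a‖²)^{1/2} : α ⊂ E, 1 ≤ |α| ≤ n}`, where `X` has law `P`. -/
noncomputable def quantError {E : Type*} [NormedAddCommGroup E] [MeasurableSpace E]
    (P : Measure E) (n : ℕ) : ℝ :=
  sInf {r : ℝ | ∃ (α : Finset E) (hα : α.Nonempty), α.card ≤ n ∧
    r = √(∫ x, α.inf' hα (fun a => ‖x - a‖ ^ 2) ∂P)}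

/-- `g` is an `n`-optimal quantizer for `P`: a Borel measurable map with at most `n` values whose
root mean square error is the minimal `n`-th quantization error of `P`. -/
structure IsOptimalQuantizer {E : Type*} [NormedAddCommGroup E] [MeasurableSpace E]
    (P : Measure E) (n : ℕ) (g : E → E) : Prop where
  measurable : Measurable g
  card_range_le : (Set.range g).encard ≤ n
  error_eq : √(∫ x, ‖x - g x‖ ^ 2 ∂P) = quantError P n

/-- `φ : (s, ∞) → (0, ∞)` is measurable and regularly varying at infinity with index `b`.
The values of `φ` outside `(s, ∞)` are irrelevant. -/
structure IsRegularlyVarying (φ : ℝ → ℝ) (s b : ℝ) : Prop where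
  measurable : Measurable (fun x : Set.Ioi s => φ x)
  pos : ∀ x ∈ Set.Ioi s, 0 < φ x
  tendsto : ∀ t : ℝ, 0 < t → Tendsto (fun x => φ (t * x) / φ x) atTop (𝓝 (t ^ b))

/-- `lam 0 ≥ lam 1 ≥ ⋯ > 0` are the ordered nonzero eigenvalues (with multiplicity) of the
covariance operator of the measure `P`, there are infinitely many of them, and `u 0, u 1, …` is a
corresponding orthonormal basis of `supp P` consisting of eigenvectors.
Indices start at `0`, so that `lam j` stands for `λ_{j+1}` and `u j` for `u_{j+1}`. -/
structure IsCovarianceEigensystem {H : Type*} [NormedAddCommGroup H] [InnerProductSpace ℝ H]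
    [CompleteSpace H] [MeasurableSpace H] [BorelSpace H]
    (P : Measure H) (lam : ℕ → ℝ) (u : ℕ → H) : Prop where
  pos : ∀ j, 0 < lam j
  antitone : Antitone lam
  orthonormal : Orthonormal ℝ u
  eigenvector : ∀ j, covarianceOperator P (u j) = lam j • u j
  basis_support : ((Submodule.span ℝ (Set.range u)).topologicalClosure : Set H) = P.support

/-- `n^{1/k} λ_j^{1/2} (∏_{i=1}^k λ_i)^{-1/(2k)}`, the solution of the continuous bit allocation
problem in dimension `k` (with `lam j` in place of `λ_j`, indices starting at `0`). -/
noncomputable def bitAllocation (lam : ℕ → ℝ) (n k j : ℕ) : ℝ :=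
  (n : ℝ) ^ (1 / (k : ℝ)) * lam j ^ (1 / 2 : ℝ) *
    (∏ i ∈ Finset.range k, lam i) ^ (-(1 / (2 * (k : ℝ))))

/-- `m(n) = max {k ≥ 1 : n^{1/k} λ_k^{1/2} (∏_{j=1}^k λ_j)^{-1/(2k)} ≥ 1}`.
The eigenvalue `λ_k` is `lam (k - 1)`. -/
noncomputable def productDim (lam : ℕ → ℝ) (n : ℕ) : ℕ :=
  sSup {k : ℕ | 1 ≤ k ∧ 1 ≤ bitAllocation lam n k (k - 1)}

/-- The integer bit allocation: the integer part of the continuous one in dimension `m(n)`. -/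
noncomputable def productLevel (lam : ℕ → ℝ) (n j : ℕ) : ℕ :=
  ⌊bitAllocation lam n (productDim lam n) j⌋₊

/-- The scalar product quantizer
`f_n^{(1)}(x) = ∑_{j=1}^{m(n)} λ_j^{1/2} g_j(x_j) u_j`, where `x_j = ⟨x, u_j⟩ / λ_j^{1/2}`. -/
noncomputable def scalarProductQuantizer {H : Type*} [NormedAddCommGroup H]
    [InnerProductSpace ℝ H] (lam : ℕ → ℝ) (u : ℕ → H) (g : ℕ → ℝ → ℝ) (n : ℕ) (x : H) : H :=
  ∑ j ∈ Finset.range (productDim lam n), (√(lam j) * g j (⟪x, u j⟫ / √(lam j))) • u j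

/-- `ψ(x) = 1 / ∫_x^∞ φ(y) dy`. -/
noncomputable def invTail (φ : ℝ → ℝ) (x : ℝ) : ℝ := 1 / ∫ y in Set.Ioi x, φ y

/-! Everything is measured against the tail integral I(x) = ∫_x^∞ φ. At index -1 one has x φ(x) =
o(I(x)) (`tendsto_mul_div_integral`), so I is slowly varying (`tendsto_integral_div`). Hence the
eigenvalue tail sums starting at log n, 2 log n or any index of order log n are all equivalent to
I(log n), and a correction of size O(log n) · λ_k with k of order log n is negligible
(`tendsto_mul_eigenvalue_div`).

Upper bound. The squared error of the product quantizer is the tail sum beyond m(n) plus the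
distortions of the first m(n) coordinates. Scalar quantizers of N(0,1) achieve distortion C/k² with
k values (`exists_quantizer_gaussianReal`), and the bit allocation makes each coordinate contribute
at most a constant times the last retained eigenvalue (`eigenvalue_div_productLevel_sq_le`). The
total is therefore the tail sum plus O(m λ_m).

Size of m(n). Taking logarithms, m(n) is the largest k with `logExcess lam k ≤ 2 log n`. Since
λ_j/λ_k is close to k/j, `logExcess lam k / k` is a Riemann sum for ∫_0^1 -log t dt = 1, so m(n) ~ 2
log n.

Lower bound. Keep only the coordinates from K on. For a code point a, minimizing over its length
leaves ‖x - a‖² ≥ ∑_{j≥K} x_j² - ⟨b_a, x⟩², where b_a is a unit vector or zero and ⟨b_a, X⟩ is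
Gaussian with variance at most λ_K. The expected maximum of n such squares is at most 4 λ_K (log n +
2) (`sum_Ico_sub_le_integral_inf`). With K = ⌊log n⌋ this loss is o(I(log n)), so both bounds agree
to first order. -/

/-! ### Regular variation of index -1 and the tail integral of φ. -/

namespace IsRegularlyVarying

variable {φ : ℝ → ℝ} {s : ℝ}

/-- Monotonicity replaces the uniform convergence theorem: y lies between (c - ε/2) x and (c + ε/2)
x, so φ(y) is squeezed between values of φ at fixed multiples of x. -/
theorem tendsto_div_of_tendsto {ι : Type*} {l : Filter ι} (hφ : IsRegularlyVarying φ s (-1))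
    (ha : AntitoneOn φ (Set.Ioi s)) {x y : ι → ℝ} {c : ℝ} (hc : 0 < c)
    (hx : Tendsto x l atTop) (hxy : Tendsto (fun i => y i / x i) l (𝓝 c)) :
    Tendsto (fun i => φ (y i) / φ (x i)) l (𝓝 c⁻¹) := by
  have hlim : ∀ t : ℝ, 0 < t → Tendsto (fun i => φ (t * x i) / φ (x i)) l (𝓝 t⁻¹) := by
    intro t ht
    have := (hφ.tendsto t ht).comp hx
    rwa [Real.rpow_neg_one] at this
  have hx0 : ∀ᶠ i in l, 0 < x i := hx.eventually_gt_atTop 0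
  have hxs : ∀ᶠ i in l, s < x i := hx.eventually_gt_atTop s
  have hbig : ∀ t : ℝ, 0 < t → ∀ᶠ i in l, s < t * x i := fun t ht =>
    (hx.const_mul_atTop ht).eventually_gt_atTop s
  have hcont : ContinuousAt (fun t : ℝ => t⁻¹) c := continuousAt_inv₀ hc.ne'
  rw [tendsto_order]
  constructor
  · intro b hb
    obtain ⟨ε, hε, hball⟩ := Metric.eventually_nhds_iff.1 (hcont.eventually (lt_mem_nhds hb))
    have hbt : b < (c + ε / 2)⁻¹ := hball (by simp [abs_of_pos hε]; linarith)
    filter_upwards [(hlim (c + ε / 2) (by positivity)).eventually (lt_mem_nhds hbt), hx0, hxs,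
      hxy.eventually (gt_mem_nhds (show c < c + ε / 2 by linarith)),
      hxy.eventually (lt_mem_nhds (show c / 2 < c by linarith)),
      hbig (c / 2) (by positivity), hbig (c + ε / 2) (by positivity)] with i h1 h2 h3 h4 h5 h6 h7
    refine h1.trans_le ?_
    have := hφ.pos _ h3
    rw [div_lt_iff₀ h2] at h4
    rw [lt_div_iff₀ h2] at h5
    gcongr
    exact ha (h6.trans h5) h7 h4.le
  · intro b hb
    obtain ⟨ε, hε, hball⟩ := Metric.eventually_nhds_iff.1
      ((hcont.eventually (gt_mem_nhds hb)).and (lt_mem_nhds hc))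
    obtain ⟨hbt, hpos⟩ := hball (y := c - ε / 2) (by
      rw [Real.dist_eq, abs_lt]; constructor <;> linarith)
    filter_upwards [(hlim (c - ε / 2) hpos).eventually (gt_mem_nhds hbt), hx0, hxs,
      hxy.eventually (lt_mem_nhds (show c - ε / 2 < c by linarith)),
      hbig (c - ε / 2) hpos] with i h1 h2 h3 h4 h5
    refine lt_of_le_of_lt ?_ h1
    have := hφ.pos _ h3
    rw [lt_div_iff₀ h2] at h4
    gcongr
    exact ha h5 (h5.trans h4) h4.le

/-- Finiteness of the tail integral comes from the integral test; in the applications summability is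
inherited from the eigenvalues. -/
theorem integrableOn_Ioi (hφ : IsRegularlyVarying φ s (-1))
    (ha : AntitoneOn φ (Set.Ioi s)) (hsum : Summable fun j : ℕ => φ ((j : ℝ) + 1))
    {x : ℝ} (hx : s < x) : IntegrableOn φ (Set.Ioi x) := by
  obtain ⟨N, hN⟩ := exists_nat_gt x
  have h1 : IntegrableOn φ (Set.Ioi (N : ℝ)) := by
    refine AntitoneOn.integrableOn_Ioi_of_summable_comp_add
      (ha.mono fun y hy => (hx.trans hN).trans_le hy) ?_
      fun t ht => (hφ.pos t (hx.trans (hN.trans ht))).le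
    have h2 : Summable fun j : ℕ => φ ((j : ℕ) : ℝ) := by
      rw [← summable_nat_add_iff 1]
      simpa using hsum
    exact (summable_nat_add_iff N).2 h2
  have h2 : IntegrableOn φ (Set.Ioc x N) := by
    rw [← intervalIntegrable_iff_integrableOn_Ioc_of_le hN.le]
    refine (ha.mono ?_).intervalIntegrable
    rw [Set.uIcc_of_le hN.le]
    exact fun y hy => hx.trans_le hy.1
  rw [← Set.Ioc_union_Ioi_eq_Ioi hN.le]
  exact h2.union h1

theorem integral_sub_mem
    (ha : AntitoneOn φ (Set.Ioi s)) (hint : ∀ x, s < x → IntegrableOn φ (Set.Ioi x))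
    {x y : ℝ} (hx : s < x) (hxy : x ≤ y) :
    (y - x) * φ y ≤ (∫ z in Set.Ioi x, φ z) - ∫ z in Set.Ioi y, φ z ∧
    (∫ z in Set.Ioi x, φ z) - ∫ z in Set.Ioi y, φ z ≤ (y - x) * φ x := by
  rw [intervalIntegral.integral_Ioi_sub_Ioi (hint x hx) hxy]
  have hii : IntervalIntegrable φ volume x y := by
    refine (ha.mono ?_).intervalIntegrable
    rw [Set.uIcc_of_le hxy]
    exact fun y hy => hx.trans_le hy.1
  constructor
  · have := intervalIntegral.integral_mono_on (f := fun _ => φ y) hxy (by simp) hii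
      fun z hz => ha (hx.trans_le hz.1) (hx.trans_le hxy) hz.2
    simpa using this
  · have := intervalIntegral.integral_mono_on (g := fun _ => φ x) hxy hii (by simp)
      fun z hz => ha hx (hx.trans_le hz.1) hz.1
    simpa using this

theorem integral_nonneg (hφ : IsRegularlyVarying φ s (-1)) {x : ℝ} (hx : s < x) :
    0 ≤ ∫ z in Set.Ioi x, φ z :=
  setIntegral_nonneg measurableSet_Ioi fun z hz => (hφ.pos z (hx.trans hz)).le

theorem integral_pos (hφ : IsRegularlyVarying φ s (-1))
    (ha : AntitoneOn φ (Set.Ioi s)) (hint : ∀ x, s < x → IntegrableOn φ (Set.Ioi x))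
    {x : ℝ} (hx : s < x) : 0 < ∫ z in Set.Ioi x, φ z := by
  have h1 := (integral_sub_mem ha hint hx (by linarith : x ≤ x + 1)).1
  have h2 := hφ.integral_nonneg (x := x + 1) (by linarith)
  have h3 := hφ.pos (x + 1) (show s < x + 1 by linarith)
  linarith

theorem sum_le_integral (hφ : IsRegularlyVarying φ s (-1))
    (ha : AntitoneOn φ (Set.Ioi s)) (hint : ∀ x, s < x → IntegrableOn φ (Set.Ioi x))
    {x : ℝ} (hx : s < x) (hx0 : 0 < x) (k : ℕ) :
    ∑ i ∈ Finset.range k, 2 ^ i * x * φ (2 ^ (i + 1) * x) ≤ ∫ z in Set.Ioi x, φ z := by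
  -- Subtracting the remaining tail makes the dyadic blocks telescope, so that induction on k works.
  suffices ∑ i ∈ Finset.range k, 2 ^ i * x * φ (2 ^ (i + 1) * x) ≤
      (∫ z in Set.Ioi x, φ z) - ∫ z in Set.Ioi (2 ^ k * x), φ z by
    have h1 : (1 : ℝ) ≤ 2 ^ k := one_le_pow₀ (by norm_num)
    have := hφ.integral_nonneg (x := 2 ^ k * x) (by nlinarith)
    linarith
  induction k with
  | zero => simp
  | succ k ih =>
    rw [Finset.sum_range_succ]
    have h1 : (1 : ℝ) ≤ 2 ^ k := one_le_pow₀ (by norm_num)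
    have h2 := (integral_sub_mem ha hint (x := 2 ^ k * x) (y := 2 ^ (k + 1) * x)
      (by nlinarith) (by rw [pow_succ]; nlinarith)).1
    have h3 : (2 : ℝ) ^ (k + 1) * x - 2 ^ k * x = 2 ^ k * x := by ring
    rw [h3] at h2
    linarith

/-- Index -1 is used here: each dyadic block [2^i x, 2^(i+1) x] contributes asymptotically at least
x φ(x)/2 to the tail integral, and the number k of blocks is arbitrary. -/
theorem tendsto_mul_div_integral (hφ : IsRegularlyVarying φ s (-1))
    (ha : AntitoneOn φ (Set.Ioi s)) (hint : ∀ x, s < x → IntegrableOn φ (Set.Ioi x)) :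
    Tendsto (fun x => x * φ x / ∫ z in Set.Ioi x, φ z) atTop (𝓝 0) := by
  suffices Tendsto (fun x => (∫ z in Set.Ioi x, φ z) / (x * φ x)) atTop atTop by
    refine this.inv_tendsto_atTop.congr fun x => ?_
    simp
  rw [tendsto_atTop]
  intro b
  obtain ⟨k, hk⟩ := exists_nat_gt (2 * b)
  have hlim : Tendsto (fun x => ∑ i ∈ Finset.range k, 2 ^ i * (φ (2 ^ (i + 1) * x) / φ x)) atTop
      (𝓝 (∑ i ∈ Finset.range k, 2 ^ i * (2 ^ (i + 1) : ℝ) ^ (-1 : ℝ))) :=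
    tendsto_finsetSum _ fun i _ => (hφ.tendsto _ (by positivity)).const_mul _
  have hval : (∑ i ∈ Finset.range k, (2 : ℝ) ^ i * (2 ^ (i + 1) : ℝ) ^ (-1 : ℝ)) = k / 2 := by
    have : ∀ i ∈ Finset.range k, (2 : ℝ) ^ i * (2 ^ (i + 1) : ℝ) ^ (-1 : ℝ) = 1 / 2 := by
      intro i _
      rw [Real.rpow_neg_one, pow_succ]
      field_simp
    rw [Finset.sum_congr rfl this]
    simp
    ring
  rw [hval] at hlim
  filter_upwards [hlim.eventually (lt_mem_nhds (show b < k / 2 by linarith)),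
    eventually_gt_atTop 0, eventually_gt_atTop s] with x h1 h2 h3
  refine h1.le.trans ?_
  have := hφ.pos x h3
  rw [le_div_iff₀ (by positivity), Finset.sum_mul]
  refine le_trans (le_of_eq ?_) (hφ.sum_le_integral ha hint h3 h2 k)
  refine Finset.sum_congr rfl fun i _ => ?_
  field_simp

/-- Slow variation of the tail integral: the two tails differ by at most |y - x| φ(min x y), which
is O(x φ(x)) and hence of smaller order. -/
theorem tendsto_integral_div {ι : Type*} {l : Filter ι} (hφ : IsRegularlyVarying φ s (-1))
    (ha : AntitoneOn φ (Set.Ioi s)) (hint : ∀ x, s < x → IntegrableOn φ (Set.Ioi x))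
    {x y : ι → ℝ} {c : ℝ} (hc : 0 < c)
    (hx : Tendsto x l atTop) (hxy : Tendsto (fun i => y i / x i) l (𝓝 c)) :
    Tendsto (fun i => (∫ z in Set.Ioi (y i), φ z) / ∫ z in Set.Ioi (x i), φ z) l (𝓝 1) := by
  have hmin : Tendsto (fun i => min (x i) (y i) / x i) l (𝓝 (min 1 c)) := by
    refine ((tendsto_const_nhds (x := (1 : ℝ))).min hxy).congr' ?_
    filter_upwards [hx.eventually_gt_atTop 0] with i hi
    rw [← min_div_div_right hi.le, div_self hi.ne']
  have h0 : Tendsto (fun i => |y i / x i - 1| * (φ (min (x i) (y i)) / φ (x i)) *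
      (x i * φ (x i) / ∫ z in Set.Ioi (x i), φ z)) l (𝓝 0) := by
    have := ((hxy.sub_const 1).abs.mul (hφ.tendsto_div_of_tendsto ha (by positivity) hx hmin)).mul
      ((hφ.tendsto_mul_div_integral ha hint).comp hx)
    simpa using this
  rw [tendsto_iff_dist_tendsto_zero]
  refine squeeze_zero' (Eventually.of_forall fun _ => dist_nonneg) ?_ h0
  have hy : Tendsto y l atTop := by
    refine (hx.atTop_mul_pos hc hxy).congr' ?_
    filter_upwards [hx.eventually_gt_atTop 0] with i hi
    field_simp
  filter_upwards [hx.eventually_gt_atTop 0, hx.eventually_gt_atTop s, hy.eventually_gt_atTop s]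
    with i h0 h1 h2
  have hI := hφ.integral_pos ha hint h1
  have hp := hφ.pos _ h1
  have key : |(∫ z in Set.Ioi (y i), φ z) - ∫ z in Set.Ioi (x i), φ z| ≤
      |y i - x i| * φ (min (x i) (y i)) := by
    rcases le_total (x i) (y i) with h | h
    · have h3 := integral_sub_mem ha hint h1 h
      have h4 := hφ.pos _ h2
      rw [min_eq_left h, abs_of_nonneg (sub_nonneg.2 h), abs_sub_comm, abs_of_nonneg]
      · exact h3.2
      · exact le_trans (mul_nonneg (sub_nonneg.2 h) h4.le) h3.1
    · have h3 := integral_sub_mem ha hint h2 h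
      rw [min_eq_right h, abs_sub_comm (y i), abs_of_nonneg (sub_nonneg.2 h), abs_of_nonneg]
      · exact h3.2
      · exact le_trans (mul_nonneg (sub_nonneg.2 h) hp.le) h3.1
  have e1 : dist ((∫ z in Set.Ioi (y i), φ z) / ∫ z in Set.Ioi (x i), φ z) 1 =
      |(∫ z in Set.Ioi (y i), φ z) - ∫ z in Set.Ioi (x i), φ z| / ∫ z in Set.Ioi (x i), φ z := by
    rw [Real.dist_eq, div_sub_one hI.ne', abs_div, abs_of_pos hI]
  have e2 : |y i / x i - 1| = |y i - x i| / x i := by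
    rw [div_sub_one h0.ne', abs_div, abs_of_pos h0]
  rw [e1, e2, div_le_iff₀ hI]
  refine key.trans (le_of_eq ?_)
  field_simp

/-- The sum lies between the tail integrals from k + 1 and from k, which are equivalent by slow
variation. -/
theorem tendsto_tsum_div_integral (hφ : IsRegularlyVarying φ s (-1))
    (ha : AntitoneOn φ (Set.Ioi s)) (hint : ∀ x, s < x → IntegrableOn φ (Set.Ioi x))
    (hsum : Summable fun j : ℕ => φ ((j : ℝ) + 1)) :
    Tendsto (fun k : ℕ => (∑' j : ℕ, φ (((j + k : ℕ) : ℝ) + 1)) / ∫ z in Set.Ioi (k : ℝ), φ z)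
      atTop (𝓝 1) := by
  have hr : Tendsto (fun k : ℕ => (∫ z in Set.Ioi ((k : ℝ) + 1), φ z) /
      ∫ z in Set.Ioi (k : ℝ), φ z) atTop (𝓝 1) := by
    refine hφ.tendsto_integral_div ha hint one_pos tendsto_natCast_atTop_atTop ?_
    have := tendsto_const_nhds (x := (1 : ℝ)).add (tendsto_one_div_atTop_nhds_zero_nat (𝕜 := ℝ))
    rw [add_zero] at this
    refine this.congr' ?_
    filter_upwards [eventually_gt_atTop 0] with k hk
    have : (k : ℝ) ≠ 0 := by positivity
    field_simp
  refine tendsto_of_tendsto_of_tendsto_of_le_of_le' hr tendsto_const_nhds ?_ ?_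
  · filter_upwards [tendsto_natCast_atTop_atTop.eventually_gt_atTop s] with k hk
    have hI := hφ.integral_pos ha hint hk
    gcongr
    have h2 : Summable fun j : ℕ => φ ((j : ℕ) : ℝ) := by
      rw [← summable_nat_add_iff 1]
      simpa using hsum
    have := AntitoneOn.integral_le_tsum_comp_add (f := φ) (k + 1)
      (ha.mono fun y hy => by
        have : ((k + 1 : ℕ) : ℝ) ≤ y := hy
        push_cast at this
        show s < y
        linarith) h2
      fun t ht => (hφ.pos t (by
        have : ((k + 1 : ℕ) : ℝ) < t := ht
        push_cast at this
        show s < t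
        linarith)).le
    push_cast at this ⊢
    simpa only [add_assoc] using this
  · filter_upwards [tendsto_natCast_atTop_atTop.eventually_gt_atTop s] with k hk
    have hI := hφ.integral_pos ha hint hk
    rw [div_le_one hI]
    have := AntitoneOn.tsum_comp_add_le_integral (f := φ) k
      (ha.mono fun y hy => hk.trans_le hy) (hint _ hk) fun t ht => (hφ.pos t (hk.trans ht)).le
    push_cast at this ⊢
    exact this

end IsRegularlyVarying

/-! ### Transfer from φ to the eigenvalues. -/

theorem tendsto_tsum_div_tsum_of_isEquivalent {f g : ℕ → ℝ} (hg : ∀ᶠ j in atTop, 0 < g j)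
    (hf : Summable f) (hgs : Summable g) (h : f ~[atTop] g) :
    Tendsto (fun k : ℕ => (∑' j, f (j + k)) / ∑' j, g (j + k)) atTop (𝓝 1) := by
  rw [Metric.tendsto_atTop]
  intro ε hε
  have h' := h.isLittleO.def (half_pos hε)
  obtain ⟨N, hN⟩ := eventually_atTop.1 (h'.and hg)
  refine ⟨N, fun k hk => ?_⟩
  have hfk := (summable_nat_add_iff k).2 hf
  have hgk := (summable_nat_add_iff k).2 hgs
  have hpos : 0 < ∑' j, g (j + k) :=
    hgk.tsum_pos (fun j => (hN _ (by omega)).2.le) 0 (hN _ (by omega)).2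
  rw [Real.dist_eq, div_sub_one hpos.ne', abs_div, abs_of_pos hpos, div_lt_iff₀ hpos,
    ← hfk.tsum_sub hgk]
  have hle : ‖∑' j, (f (j + k) - g (j + k))‖ ≤ ∑' j, ε / 2 * g (j + k) := by
    refine tsum_of_norm_bounded (hgk.mul_left (ε / 2)).hasSum fun j => ?_
    have := (hN (j + k) (by omega))
    have h2 := this.1
    rw [Real.norm_of_nonneg this.2.le] at h2
    exact h2
  rw [tsum_mul_left, Real.norm_eq_abs] at hle
  nlinarith

section Eigenvalues

variable {φ : ℝ → ℝ} {s : ℝ} {lam : ℕ → ℝ}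

theorem tendsto_eigenvalue_div {ι : Type*} {l : Filter ι} (hφ : IsRegularlyVarying φ s (-1))
    (ha : AntitoneOn φ (Set.Ioi s)) (hlamφ : lam ~[atTop] fun j : ℕ => φ ((j : ℝ) + 1))
    {x : ι → ℝ} {k : ι → ℕ} {c : ℝ} (hc : 0 < c)
    (hx : Tendsto x l atTop) (hk : Tendsto (fun i => (k i : ℝ) / x i) l (𝓝 c)) :
    Tendsto (fun i => lam (k i) / φ (x i)) l (𝓝 c⁻¹) := by
  have hkx : Tendsto (fun i => ((k i : ℝ) + 1) / x i) l (𝓝 c) := by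
    have := hk.add hx.inv_tendsto_atTop
    rw [add_zero] at this
    refine this.congr fun i => ?_
    simp only [Pi.inv_apply]
    ring
  have hkreal : Tendsto (fun i => (k i : ℝ)) l atTop := by
    refine (hx.atTop_mul_pos hc hk).congr' ?_
    filter_upwards [hx.eventually_gt_atTop 0] with i hi
    field_simp
  have hknat : Tendsto k l atTop := tendsto_natCast_atTop_iff.1 hkreal
  have hpos : ∀ᶠ j : ℕ in atTop, φ ((j : ℝ) + 1) ≠ 0 := by
    filter_upwards [tendsto_natCast_atTop_atTop.eventually_gt_atTop s] with j hj
    exact (hφ.pos _ (show s < (j : ℝ) + 1 by linarith)).ne'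
  have h1 := ((isEquivalent_iff_tendsto_one hpos).1 hlamφ).comp hknat
  have h2 := h1.mul (hφ.tendsto_div_of_tendsto ha hc hx hkx)
  rw [one_mul] at h2
  refine h2.congr' ?_
  filter_upwards [hknat.eventually hpos] with i hi
  simp only [Function.comp, Pi.div_apply]
  field_simp

theorem tendsto_tsum_eigenvalue_div {ι : Type*} {l : Filter ι} (hφ : IsRegularlyVarying φ s (-1))
    (ha : AntitoneOn φ (Set.Ioi s)) (hlamφ : lam ~[atTop] fun j : ℕ => φ ((j : ℝ) + 1))
    (hsum : Summable lam) {x : ι → ℝ} {k : ι → ℕ} {c : ℝ} (hc : 0 < c)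
    (hx : Tendsto x l atTop) (hk : Tendsto (fun i => (k i : ℝ) / x i) l (𝓝 c)) :
    Tendsto (fun i => (∑' j, lam (j + k i)) / ∫ z in Set.Ioi (x i), φ z) l (𝓝 1) := by
  have hφsum : Summable fun j : ℕ => φ ((j : ℝ) + 1) := hlamφ.summable_iff_nat.1 hsum
  have hint : ∀ x, s < x → IntegrableOn φ (Set.Ioi x) := fun x hx =>
    hφ.integrableOn_Ioi ha hφsum hx
  have hkreal : Tendsto (fun i => (k i : ℝ)) l atTop := by
    refine (hx.atTop_mul_pos hc hk).congr' ?_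
    filter_upwards [hx.eventually_gt_atTop 0] with i hi
    field_simp
  have hknat : Tendsto k l atTop := tendsto_natCast_atTop_iff.1 hkreal
  have hpos : ∀ᶠ j : ℕ in atTop, 0 < φ ((j : ℝ) + 1) := by
    filter_upwards [tendsto_natCast_atTop_atTop.eventually_gt_atTop s] with j hj
    exact hφ.pos _ (show s < (j : ℝ) + 1 by linarith)
  have h1 := (tendsto_tsum_div_tsum_of_isEquivalent hpos hsum hφsum hlamφ).comp hknat
  have h2 := (hφ.tendsto_tsum_div_integral ha hint hφsum).comp hknat
  have h3 := hφ.tendsto_integral_div ha hint hc hx hk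
  have h4 := (h1.mul h2).mul h3
  rw [one_mul, one_mul] at h4
  refine h4.congr' ?_
  filter_upwards [h2.eventually (lt_mem_nhds one_pos), hkreal.eventually_gt_atTop s] with i h5 h6
  have h7 := hφ.integral_pos ha hint h6
  simp only [Function.comp] at h5 ⊢
  have h8 : (∑' j : ℕ, φ (((j + k i : ℕ) : ℝ) + 1)) ≠ 0 := by
    intro h
    rw [h] at h5
    simp at h5
  field_simp

/-- This disposes of the error terms in both bounds: y/x and λ_k/φ(x) converge, while x φ(x) is
negligible against the tail integral. -/
theorem tendsto_mul_eigenvalue_div {ι : Type*} {l : Filter ι} (hφ : IsRegularlyVarying φ s (-1))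
    (ha : AntitoneOn φ (Set.Ioi s)) (hlamφ : lam ~[atTop] fun j : ℕ => φ ((j : ℝ) + 1))
    (hsum : Summable lam) {x y : ι → ℝ} {k : ι → ℕ} {c d : ℝ} (hc : 0 < c)
    (hx : Tendsto x l atTop) (hk : Tendsto (fun i => (k i : ℝ) / x i) l (𝓝 c))
    (hy : Tendsto (fun i => y i / x i) l (𝓝 d)) :
    Tendsto (fun i => (y i * lam (k i)) / ∫ z in Set.Ioi (x i), φ z) l (𝓝 0) := by
  have hφsum : Summable fun j : ℕ => φ ((j : ℝ) + 1) := hlamφ.summable_iff_nat.1 hsum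
  have hint : ∀ x, s < x → IntegrableOn φ (Set.Ioi x) := fun x hx =>
    hφ.integrableOn_Ioi ha hφsum hx
  have h1 := (hy.mul (tendsto_eigenvalue_div hφ ha hlamφ hc hx hk)).mul
    ((hφ.tendsto_mul_div_integral ha hint).comp hx)
  rw [mul_zero] at h1
  refine h1.congr' ?_
  filter_upwards [hx.eventually_gt_atTop s, hx.eventually_gt_atTop 0] with i h2 h3
  have h4 := hφ.pos _ h2
  simp only [Function.comp]
  field_simp

/-! ### Logarithmic excess of the eigenvalues. -/

/-- The total logarithmic excess of the first `k` eigenvalues over the `k`-th one. -/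
noncomputable def logExcess (lam : ℕ → ℝ) (k : ℕ) : ℝ :=
  ∑ j ∈ Finset.range k, (Real.log (lam j) - Real.log (lam (k - 1)))

/-- Writing an average as the integral of a step function over (0, 1) opens the way to dominated
convergence. -/
theorem integral_ceil_eq_sum (h : ℕ → ℝ) {m : ℕ} (hm : 0 < m) :
    ∫ t in (0 : ℝ)..1, h (⌈(m : ℝ) * t⌉₊ - 1) = (∑ j ∈ Finset.range m, h j) / m := by
  have hm' : (0 : ℝ) < m := by exact_mod_cast hm
  have hpiece : ∀ i : ℕ, Set.EqOn (fun t : ℝ => h (⌈(m : ℝ) * t⌉₊ - 1)) (fun _ => h i)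
      (Set.Ioc ((i : ℝ) / m) (((i + 1 : ℕ) : ℝ) / m)) := by
    intro i t ht
    have h1 : ⌈(m : ℝ) * t⌉₊ = i + 1 := by
      rw [Nat.ceil_eq_iff (by omega)]
      have h2 := (div_lt_iff₀ hm').1 ht.1
      have h3 := (le_div_iff₀ hm').1 ht.2
      constructor
      · simp; linarith
      · linarith
    simp [h1]
  have hle : ∀ i : ℕ, (i : ℝ) / m ≤ ((i + 1 : ℕ) : ℝ) / m := fun i => by
    gcongr; simp
  have hsum := intervalIntegral.sum_integral_adjacent_intervals (n := m) (μ := volume)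
    (f := fun t : ℝ => h (⌈(m : ℝ) * t⌉₊ - 1)) (a := fun i : ℕ => (i : ℝ) / m) fun i _ => by
      rw [intervalIntegrable_iff_integrableOn_Ioc_of_le (hle i)]
      exact (integrableOn_congr_fun (hpiece i) measurableSet_Ioc).2 (by simp)
  rw [div_self hm'.ne', Nat.cast_zero, zero_div] at hsum
  rw [← hsum, Finset.sum_div]
  refine Finset.sum_congr rfl fun i _ => ?_
  rw [intervalIntegral.integral_of_le (hle i), setIntegral_congr_fun measurableSet_Ioc (hpiece i),
    ← intervalIntegral.integral_of_le (hle i), intervalIntegral.integral_const, smul_eq_mul]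
  push_cast
  field_simp
  ring

/-- A Potter-type bound: doubling j costs at most A, and about log₂(m/j) doublings lead from j to m.
It supplies an integrable majorant of the form A (1 - log t / log 2). The number d bounds m - j,
which shrinks when j is replaced by 2j. -/
theorem log_sub_log_le {A : ℝ} (hA : 0 ≤ A) {h : ℕ → ℝ} (hanti : Antitone h)
    (hdouble : ∀ k, 1 ≤ k → h (k - 1) - h (2 * k - 1) ≤ A) (d : ℕ) :
    ∀ j m : ℕ, 1 ≤ j → j ≤ m → m - j ≤ d →
      h (j - 1) - h (m - 1) ≤ A * (1 + Real.logb 2 (m / j)) := by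
  induction d using Nat.strong_induction_on with
  | _ d ih =>
    intro j m hj hjm hd
    have hj' : (0 : ℝ) < j := by exact_mod_cast hj
    have hjm' : (j : ℝ) ≤ m := by exact_mod_cast hjm
    rcases le_total m (2 * j) with h2 | h2
    · have h3 : 0 ≤ Real.logb 2 ((m : ℝ) / j) :=
        Real.logb_nonneg (by norm_num) ((one_le_div hj').2 hjm')
      have h4 := hanti (show m - 1 ≤ 2 * j - 1 by omega)
      have h5 := hdouble j hj
      nlinarith
    · have h3 := ih (m - 2 * j) (by omega) (2 * j) m (by omega) h2 le_rfl
      have h5 := hdouble j hj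
      have h6 : Real.logb 2 ((m : ℝ) / ((2 * j : ℕ) : ℝ)) = Real.logb 2 ((m : ℝ) / j) - 1 := by
        have : (m : ℝ) / ((2 * j : ℕ) : ℝ) = (m / j) / 2 := by
          push_cast
          field_simp
        rw [this, Real.logb_div (div_pos (hj'.trans_le hjm') hj').ne' (by norm_num), Real.logb_self_eq_one (by norm_num)]
      rw [h6] at h3
      linarith

/-- The integrand log(λ_⌈mt⌉/λ_m) tends to -log t for each t in (0, 1], because λ_j is regularly
varying of index -1. -/
theorem tendsto_logExcess_div (hφ : IsRegularlyVarying φ s (-1))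
    (ha : AntitoneOn φ (Set.Ioi s)) (hlamφ : lam ~[atTop] fun j : ℕ => φ ((j : ℝ) + 1))
    (hpos : ∀ j, 0 < lam j) (hanti : Antitone lam) :
    Tendsto (fun k : ℕ => logExcess lam k / k) atTop (𝓝 1) := by
  have hnat : Tendsto (fun m : ℕ => (m : ℝ)) atTop atTop := tendsto_natCast_atTop_atTop
  have hlog : Antitone fun j => Real.log (lam j) := fun i j hij =>
    Real.log_le_log (hpos j) (hanti hij)
  have hself : Tendsto (fun m : ℕ => lam (m - 1) / φ m) atTop (𝓝 1) := by
    have := tendsto_eigenvalue_div (k := fun m : ℕ => m - 1) hφ ha hlamφ one_pos hnat (by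
      have := tendsto_const_nhds (x := (1 : ℝ)).sub
        (tendsto_one_div_atTop_nhds_zero_nat (𝕜 := ℝ))
      rw [sub_zero] at this
      refine this.congr' ?_
      filter_upwards [eventually_gt_atTop 0] with m hm
      rw [Nat.cast_pred hm]
      have : (m : ℝ) ≠ 0 := by positivity
      field_simp)
    simpa using this
  have hratio : ∀ (k : ℕ → ℕ) (c : ℝ), 0 < c → Tendsto (fun m : ℕ => (k m : ℝ) / m) atTop (𝓝 c) →
      Tendsto (fun m : ℕ => Real.log (lam (k m)) - Real.log (lam (m - 1))) atTop
        (𝓝 (-Real.log c)) := by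
    intro k c hc hk
    have h1 := (tendsto_eigenvalue_div hφ ha hlamφ hc hnat hk).div hself one_ne_zero
    rw [div_one] at h1
    have h2 := h1.log (inv_ne_zero hc.ne')
    rw [Real.log_inv] at h2
    refine h2.congr' ?_
    filter_upwards [hnat.eventually_gt_atTop s] with m hm
    have := hφ.pos _ hm
    rw [Pi.div_apply, div_div_div_cancel_right₀ this.ne',
      Real.log_div (hpos _).ne' (hpos _).ne']
  obtain ⟨A, hA⟩ : ∃ A, ∀ k : ℕ, Real.log (lam (k - 1)) - Real.log (lam (2 * k - 1)) ≤ A := by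
    have h1 := hratio (fun m => 2 * m - 1) 2 two_pos (by
      have := tendsto_const_nhds (x := (2 : ℝ)).sub
        (tendsto_one_div_atTop_nhds_zero_nat (𝕜 := ℝ))
      rw [sub_zero] at this
      refine this.congr' ?_
      filter_upwards [eventually_gt_atTop 0] with m hm
      rw [Nat.cast_pred (by omega)]
      have : (m : ℝ) ≠ 0 := by positivity
      push_cast
      field_simp)
    obtain ⟨A, hA⟩ := h1.neg.bddAbove_range
    refine ⟨A, fun k => ?_⟩
    have := hA ⟨k, rfl⟩
    simpa using this
  -- At k = 0 both truncated indices equal 0, so the difference vanishes.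
  have hA0 : 0 ≤ A := by simpa using hA 0
  have hdct : Tendsto (fun m : ℕ => ∫ t in (0 : ℝ)..1,
      (Real.log (lam (⌈(m : ℝ) * t⌉₊ - 1)) - Real.log (lam (m - 1)))) atTop
      (𝓝 (∫ t in (0 : ℝ)..1, -Real.log t)) := by
    refine intervalIntegral.tendsto_integral_filter_of_dominated_convergence
      (fun t => A * (1 + -(Real.log t) / Real.log 2)) ?_ ?_ ?_ ?_
    · refine Eventually.of_forall fun m => Measurable.aestronglyMeasurable ?_
      exact ((measurable_from_nat (f := fun i => Real.log (lam (i - 1)))).comp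
        (Nat.measurable_ceil.comp (measurable_const_mul _))).sub_const _
    · filter_upwards [eventually_gt_atTop 0] with m hm
      refine Eventually.of_forall fun t ht => ?_
      rw [Set.uIoc_of_le zero_le_one] at ht
      have hm' : (0 : ℝ) < m := by exact_mod_cast hm
      have h1 : 1 ≤ ⌈(m : ℝ) * t⌉₊ := Nat.one_le_ceil_iff.2 (mul_pos hm' ht.1)
      have h2 : ⌈(m : ℝ) * t⌉₊ ≤ m := Nat.ceil_le.2 (by nlinarith [ht.2])
      have h3 : (m : ℝ) * t ≤ ⌈(m : ℝ) * t⌉₊ := Nat.le_ceil _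
      have h4 := log_sub_log_le hA0 hlog (fun k _ => hA k) _ _ _ h1 h2 le_rfl
      rw [Real.norm_of_nonneg (sub_nonneg.2 (hlog (by omega)))]
      refine h4.trans ?_
      have h5 : Real.logb 2 ((m : ℝ) / ⌈(m : ℝ) * t⌉₊) ≤ -(Real.log t) / Real.log 2 := by
        rw [← Real.log_inv, Real.log_div_log]
        have h6 : 0 < (m : ℝ) * t := mul_pos hm' ht.1
        refine Real.logb_le_logb_of_le one_lt_two (div_pos hm' (h6.trans_le h3)) ?_
        rw [div_le_iff₀ (h6.trans_le h3), inv_mul_eq_div, le_div_iff₀ ht.1]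
        exact h3
      gcongr
    · exact ((intervalIntegrable_const.add
        (intervalIntegral.intervalIntegrable_log'.neg.div_const _)).const_mul _)
    · refine Eventually.of_forall fun t ht => ?_
      rw [Set.uIoc_of_le zero_le_one] at ht
      refine hratio (fun m => ⌈(m : ℝ) * t⌉₊ - 1) t ht.1 ?_
      have h1 : Tendsto (fun m : ℕ => t - 1 / (m : ℝ)) atTop (𝓝 t) := by
        simpa using tendsto_const_nhds (x := t).sub
          (tendsto_one_div_atTop_nhds_zero_nat (𝕜 := ℝ))
      refine tendsto_of_tendsto_of_tendsto_of_le_of_le' h1 tendsto_const_nhds ?_ ?_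
      all_goals
        filter_upwards [eventually_gt_atTop 0] with m hm
        have hm' : (0 : ℝ) < m := by exact_mod_cast hm
        have h2 : 0 < ⌈(m : ℝ) * t⌉₊ := Nat.ceil_pos.2 (mul_pos hm' ht.1)
        have h3 : (m : ℝ) * t ≤ ⌈(m : ℝ) * t⌉₊ := Nat.le_ceil _
        have h4 := Nat.ceil_lt_add_one (mul_pos hm' ht.1).le
        rw [Nat.cast_pred h2]
      · rw [le_div_iff₀ hm']
        have h5 : (t - 1 / (m : ℝ)) * m = m * t - 1 := by field_simp
        linarith
      · rw [div_le_iff₀ hm']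
        linarith
  have hval : ∫ t in (0 : ℝ)..1, -Real.log t = 1 := by
    rw [intervalIntegral.integral_neg, integral_log]
    simp
  rw [hval] at hdct
  refine hdct.congr' ?_
  filter_upwards [eventually_gt_atTop 0] with m hm
  exact integral_ceil_eq_sum (fun j => Real.log (lam j) - Real.log (lam (m - 1))) hm

/-! ### Bit allocation and the dimension m(n). -/

theorem bitAllocation_pos (hpos : ∀ j, 0 < lam j) {n : ℕ} (hn : 1 ≤ n) (k j : ℕ) :
    0 < bitAllocation lam n k j := by
  have h1 : (0 : ℝ) < n := by exact_mod_cast hn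
  have h2 := hpos j
  have h3 : 0 < ∏ i ∈ Finset.range k, lam i := Finset.prod_pos fun i _ => hpos i
  unfold bitAllocation
  positivity

theorem log_bitAllocation (hpos : ∀ j, 0 < lam j) {n : ℕ} (hn : 1 ≤ n) (k j : ℕ) :
    Real.log (bitAllocation lam n k j) = 1 / k * Real.log n + 1 / 2 * Real.log (lam j) -
      1 / (2 * k) * ∑ i ∈ Finset.range k, Real.log (lam i) := by
  have h1 : (0 : ℝ) < n := by exact_mod_cast hn
  have h2 := hpos j
  have h3 : 0 < ∏ i ∈ Finset.range k, lam i := Finset.prod_pos fun i _ => hpos i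
  unfold bitAllocation
  rw [Real.log_mul (by positivity) (by positivity), Real.log_mul (by positivity) (by positivity),
    Real.log_rpow h1, Real.log_rpow h2, Real.log_rpow h3, Real.log_prod fun i _ => (hpos i).ne']
  ring

theorem one_le_bitAllocation_iff (hpos : ∀ j, 0 < lam j) {n : ℕ} (hn : 1 ≤ n) {k : ℕ}
    (hk : 1 ≤ k) : 1 ≤ bitAllocation lam n k (k - 1) ↔ logExcess lam k ≤ 2 * Real.log n := by
  have hk' : (0 : ℝ) < k := by exact_mod_cast hk
  rw [← Real.log_nonneg_iff (bitAllocation_pos hpos hn _ _), log_bitAllocation hpos hn]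
  have : 1 / (k : ℝ) * Real.log n + 1 / 2 * Real.log (lam (k - 1)) -
      1 / (2 * k) * ∑ i ∈ Finset.range k, Real.log (lam i) =
      (2 * Real.log n - logExcess lam k) / (2 * k) := by
    rw [logExcess, Finset.sum_sub_distrib, Finset.sum_const, Finset.card_range, nsmul_eq_mul]
    field_simp
    ring
  rw [this, le_div_iff₀ (by positivity), zero_mul, sub_nonneg]

/-- The supremum is a genuine maximum: k = 1 has zero excess, and the excess tends to infinity, so
the set is nonempty and bounded. -/
theorem productDim_spec (hpos : ∀ j, 0 < lam j)
    (hexc : Tendsto (fun k : ℕ => logExcess lam k / k) atTop (𝓝 1)) {n : ℕ} (hn : 1 ≤ n) :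
    1 ≤ productDim lam n ∧ logExcess lam (productDim lam n) ≤ 2 * Real.log n ∧
      ∀ k, 1 ≤ k → logExcess lam k ≤ 2 * Real.log n → k ≤ productDim lam n := by
  have hset : {k : ℕ | 1 ≤ k ∧ 1 ≤ bitAllocation lam n k (k - 1)} =
      {k : ℕ | 1 ≤ k ∧ logExcess lam k ≤ 2 * Real.log n} := by
    ext k
    exact and_congr_right fun hk => one_le_bitAllocation_iff hpos hn hk
  have hne : {k : ℕ | 1 ≤ k ∧ logExcess lam k ≤ 2 * Real.log n}.Nonempty :=
    ⟨1, le_rfl, by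
      have := Real.log_natCast_nonneg n
      simp [logExcess, this]⟩
  have hbdd : BddAbove {k : ℕ | 1 ≤ k ∧ logExcess lam k ≤ 2 * Real.log n} := by
    have htop : Tendsto (fun k : ℕ => logExcess lam k) atTop atTop := by
      refine (tendsto_natCast_atTop_atTop.atTop_mul_pos one_pos hexc).congr' ?_
      filter_upwards [eventually_gt_atTop 0] with k hk
      have : (k : ℝ) ≠ 0 := by positivity
      field_simp
    obtain ⟨N, hN⟩ := eventually_atTop.1 (htop.eventually_gt_atTop (2 * Real.log n))
    refine ⟨N, fun k hk => ?_⟩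
    by_contra h
    exact absurd hk.2 (not_le.2 (hN k (not_le.1 h).le))
  have hmem := Nat.sSup_mem hne hbdd
  rw [productDim, hset]
  exact ⟨hmem.1, hmem.2, fun k h1 h2 => le_csSup hbdd ⟨h1, h2⟩⟩

/-- Maximality gives logExcess(m) ≤ 2 log n < logExcess(m + 1), and both ends are equivalent to m.
-/
theorem tendsto_productDim_div_log (hpos : ∀ j, 0 < lam j)
    (hexc : Tendsto (fun k : ℕ => logExcess lam k / k) atTop (𝓝 1)) :
    Tendsto (fun n : ℕ => (productDim lam n : ℝ) / Real.log n) atTop (𝓝 2) := by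
  have hlog : Tendsto (fun n : ℕ => Real.log (n : ℝ)) atTop atTop :=
    Real.tendsto_log_atTop.comp tendsto_natCast_atTop_atTop
  have hm : Tendsto (fun n : ℕ => productDim lam n) atTop atTop := by
    rw [tendsto_atTop]
    intro b
    filter_upwards [hlog.eventually_ge_atTop (logExcess lam (b + 1) / 2), eventually_ge_atTop 1]
      with n h1 h2
    have := (productDim_spec hpos hexc h2).2.2 (b + 1) (by omega) (by linarith)
    omega
  have h1 := hexc.comp hm
  have h2 : Tendsto (fun k : ℕ => logExcess lam (k + 1) / k) atTop (𝓝 1) := by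
    have h3 := (hexc.comp (tendsto_add_atTop_nat 1)).mul
      (tendsto_const_nhds (x := (1 : ℝ)).add (tendsto_one_div_atTop_nhds_zero_nat (𝕜 := ℝ)))
    rw [add_zero, one_mul] at h3
    refine h3.congr' ?_
    filter_upwards [eventually_gt_atTop 0] with k hk
    have : (k : ℝ) ≠ 0 := by positivity
    simp only [Function.comp]
    push_cast
    field_simp
  have h3 : Tendsto (fun n : ℕ => 2 * Real.log n / productDim lam n) atTop (𝓝 1) := by
    refine tendsto_of_tendsto_of_tendsto_of_le_of_le' h1 (h2.comp hm) ?_ ?_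
    · filter_upwards [eventually_ge_atTop 1] with n hn
      simp only [Function.comp]
      gcongr
      exact (productDim_spec hpos hexc hn).2.1
    · filter_upwards [eventually_ge_atTop 1] with n hn
      simp only [Function.comp]
      gcongr
      by_contra h
      have := (productDim_spec hpos hexc hn).2.2 (productDim lam n + 1) (by omega)
        (not_le.1 h).le
      omega
  have h4 := (h3.inv₀ one_ne_zero).const_mul 2
  rw [inv_one, mul_one] at h4
  refine h4.congr fun n => ?_
  rw [inv_div, mul_div_assoc', mul_div_mul_left _ _ two_ne_zero]

/-- Up to a factor `4`, every coordinate of the integer bit allocation contributes the same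
distortion, at most that of the last eigenvalue. -/
theorem eigenvalue_div_productLevel_sq_le (hpos : ∀ j, 0 < lam j) (hanti : Antitone lam)
    (hexc : Tendsto (fun k : ℕ => logExcess lam k / k) atTop (𝓝 1)) {n : ℕ} (hn : 1 ≤ n) {j : ℕ}
    (hj : j < productDim lam n) :
    1 ≤ productLevel lam n j ∧
      lam j / (productLevel lam n j : ℝ) ^ 2 ≤ 4 * lam (productDim lam n - 1) := by
  obtain ⟨hm1, hm2, -⟩ := productDim_spec hpos hexc hn
  rw [← one_le_bitAllocation_iff hpos hn hm1] at hm2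
  set m := productDim lam n with hm
  -- The squared allocation is `lam i * c` with c independent of i, and the choice of m says exactly
  -- that `lam (m - 1) * c ≥ 1`.
  have hsq : ∀ i, bitAllocation lam n m i ^ 2 = lam i *
      ((n : ℝ) ^ (1 / (m : ℝ)) * (∏ i ∈ Finset.range m, lam i) ^ (-(1 / (2 * (m : ℝ))))) ^ 2 := by
    intro i
    have : (lam i ^ (1 / 2 : ℝ)) ^ 2 = lam i := by
      rw [← Real.sqrt_eq_rpow, Real.sq_sqrt (hpos i).le]
    rw [bitAllocation, mul_right_comm, mul_pow, this]
    ring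
  set c := ((n : ℝ) ^ (1 / (m : ℝ)) * (∏ i ∈ Finset.range m, lam i) ^ (-(1 / (2 * (m : ℝ))))) ^ 2
  have hj0 := bitAllocation_pos hpos hn m j
  have hlast : 1 ≤ lam (m - 1) * c := by
    rw [← hsq]
    exact one_le_pow₀ hm2
  have hlj : lam (m - 1) ≤ lam j := hanti (by omega)
  have hc : 0 < c := by
    by_contra h
    have := mul_nonpos_of_nonneg_of_nonpos (hpos (m - 1)).le (not_lt.1 h)
    linarith
  have hge : 1 ≤ bitAllocation lam n m j := by
    refine (one_le_sq_iff₀ hj0.le).1 ?_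
    rw [hsq]
    exact hlast.trans (by gcongr)
  have hfl : 1 ≤ productLevel lam n j := Nat.le_floor (by simpa using hge)
  refine ⟨hfl, ?_⟩
  have hfl' : (1 : ℝ) ≤ productLevel lam n j := by exact_mod_cast hfl
  have hlt : bitAllocation lam n m j < productLevel lam n j + 1 := Nat.lt_floor_add_one _
  -- Rounding down a number that is at least 1 loses less than a factor 2; squared, this is the
  -- constant 4.
  have hhalf : bitAllocation lam n m j ^ 2 ≤ (2 * productLevel lam n j) ^ 2 := by
    gcongr
    linarith
  rw [hsq] at hhalf
  have hlj0 := hpos j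
  rw [div_le_iff₀ (by positivity)]
  have h5 : lam j * (lam (m - 1) * c) ≤ lam (m - 1) * (2 * (productLevel lam n j : ℝ)) ^ 2 := by
    have := mul_le_mul_of_nonneg_left hhalf (hpos (m - 1)).le
    linarith
  nlinarith

/-- Before rounding the levels multiply to exactly n. -/
theorem prod_productLevel_le (hpos : ∀ j, 0 < lam j) {n : ℕ} (hn : 1 ≤ n)
    (hm : 1 ≤ productDim lam n) :
    ∏ j ∈ Finset.range (productDim lam n), productLevel lam n j ≤ n := by
  have hn' : (0 : ℝ) < n := by exact_mod_cast hn
  have hm' : (productDim lam n : ℝ) ≠ 0 := by positivity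
  have h1 : ∏ j ∈ Finset.range (productDim lam n), bitAllocation lam n (productDim lam n) j = n := by
    refine Real.log_injOn_pos (Finset.prod_pos fun j _ => bitAllocation_pos hpos hn _ j) hn' ?_
    rw [Real.log_prod fun j _ => (bitAllocation_pos hpos hn _ j).ne']
    simp_rw [log_bitAllocation hpos hn]
    rw [Finset.sum_sub_distrib, Finset.sum_add_distrib, Finset.sum_const, Finset.sum_const,
      Finset.card_range, ← Finset.mul_sum]
    simp only [nsmul_eq_mul]
    field_simp
    ring
  have h2 : ((∏ j ∈ Finset.range (productDim lam n), productLevel lam n j : ℕ) : ℝ) ≤ n := by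
    rw [← h1]
    push_cast
    exact Finset.prod_le_prod (fun _ _ => by positivity)
      fun j _ => Nat.floor_le (bitAllocation_pos hpos hn _ j).le
  exact_mod_cast h2

end Eigenvalues

/-! ### The quantization error as an infimum. -/

section Quantizers

variable {E : Type*} [NormedAddCommGroup E] [MeasurableSpace E] {P : Measure E}

theorem quantError_nonneg (P : Measure E) (n : ℕ) : 0 ≤ quantError P n := by
  refine Real.sInf_nonneg ?_
  rintro r ⟨α, hα, -, rfl⟩
  exact Real.sqrt_nonneg _

theorem quantError_le_of_range_subset {n : ℕ} {f : E → E} {α : Finset E}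
    (hf : Set.range f ⊆ α) (hcard : α.card ≤ n) (hint : Integrable (fun x => ‖x - f x‖ ^ 2) P) :
    quantError P n ≤ √(∫ x, ‖x - f x‖ ^ 2 ∂P) := by
  have hne : α.Nonempty := ⟨f 0, hf ⟨0, rfl⟩⟩
  have hnn : ∀ x, 0 ≤ α.inf' hne (fun a => ‖x - a‖ ^ 2) := fun x =>
    (Finset.le_inf'_iff hne _).2 fun a _ => by positivity
  rw [quantError]
  refine le_trans (csInf_le ?_ ⟨α, hne, hcard, rfl⟩) (Real.sqrt_le_sqrt ?_)
  · refine ⟨0, ?_⟩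
    rintro r ⟨β, hβ, -, rfl⟩
    exact Real.sqrt_nonneg _
  · exact integral_mono_of_nonneg (Eventually.of_forall hnn) hint
      (Eventually.of_forall fun x => Finset.inf'_le _ (hf ⟨x, rfl⟩))

theorem le_quantError_sq {n : ℕ} (hn : 1 ≤ n) {B : ℝ}
    (h : ∀ (α : Finset E) (hα : α.Nonempty), α.card ≤ n →
      B ≤ ∫ x, α.inf' hα (fun a => ‖x - a‖ ^ 2) ∂P) :
    B ≤ quantError P n ^ 2 := by
  refine (Real.sqrt_le_left (quantError_nonneg P n)).1 ?_
  -- A one-point codebook is admissible because n ≥ 1; over an empty set the infimum would default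
  -- to 0.
  refine le_csInf ⟨_, {0}, Finset.singleton_nonempty 0, by simpa using hn, rfl⟩ ?_
  rintro r ⟨α, hα, hcard, rfl⟩
  exact Real.sqrt_le_sqrt (h α hα hcard)

end Quantizers

/-! ### Scalar quantization and exponential moments of N(0, 1). -/

section StandardGaussian

/-- Rounding of `z / (1 + |z|)` towards `0` on the grid `{i / N}`, transported back to `ℝ`. -/
noncomputable def compandingQuantizer (N : ℕ) (z : ℝ) : ℝ :=
  if 0 ≤ z then (⌊N * (|z| / (1 + |z|))⌋₊ : ℝ) / (N - ⌊N * (|z| / (1 + |z|))⌋₊)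
  else -((⌊N * (|z| / (1 + |z|))⌋₊ : ℝ) / (N - ⌊N * (|z| / (1 + |z|))⌋₊))

theorem floor_mul_div_lt {N : ℕ} (hN : 1 ≤ N) (z : ℝ) : ⌊N * (|z| / (1 + |z|))⌋₊ < N := by
  have hN' : (0 : ℝ) < N := by exact_mod_cast hN
  have hz := abs_nonneg z
  rw [Nat.floor_lt (by positivity)]
  have : |z| / (1 + |z|) < 1 := by
    rw [div_lt_one (by positivity)]
    linarith
  nlinarith

theorem measurable_compandingQuantizer (N : ℕ) : Measurable (compandingQuantizer N) := by
  have h1 : Measurable fun z : ℝ => (⌊N * (|z| / (1 + |z|))⌋₊ : ℝ) :=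
    (measurable_from_nat (f := fun i : ℕ => (i : ℝ))).comp
      (Nat.measurable_floor.comp (by fun_prop))
  exact Measurable.ite measurableSet_Ici (h1.div (measurable_const.sub h1))
    (h1.div (measurable_const.sub h1)).neg

/-- With t = |z|, the grid error 1/N is magnified by the inverse of t ↦ t/(1 + t), whose slope is at
most (1 + t)² up to t since rounding goes towards 0. A fourth moment then controls the distortion.
-/
theorem norm_sub_compandingQuantizer_le {N : ℕ} (hN : 1 ≤ N) (z : ℝ) :
    ‖z - compandingQuantizer N z‖ ≤ (1 + |z|) ^ 2 / N := by
  have hN' : (0 : ℝ) < N := by exact_mod_cast hN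
  have key : |(|z| - (⌊N * (|z| / (1 + |z|))⌋₊ : ℝ) / (N - ⌊N * (|z| / (1 + |z|))⌋₊))| ≤
      (1 + |z|) ^ 2 / N := by
    have hz := abs_nonneg z
    set t := |z|
    have h1 : (⌊N * (t / (1 + t))⌋₊ : ℝ) ≤ N * (t / (1 + t)) := Nat.floor_le (by positivity)
    have h2 : N * (t / (1 + t)) < ⌊N * (t / (1 + t))⌋₊ + 1 := Nat.lt_floor_add_one _
    have h3 : (⌊N * (t / (1 + t))⌋₊ : ℝ) < N := by exact_mod_cast floor_mul_div_lt hN z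
    set i : ℝ := ((⌊N * (t / (1 + t))⌋₊ : ℕ) : ℝ)
    rw [← mul_div_assoc, le_div_iff₀ (by positivity)] at h1
    rw [← mul_div_assoc, div_lt_iff₀ (by positivity)] at h2
    have h4 : 0 < N - i := by linarith
    have h5 : i / (N - i) ≤ t := by
      rw [div_le_iff₀ h4]
      linarith
    have h6 : i / (N - i) * (N - i) = i := div_mul_cancel₀ _ h4.ne'
    rw [abs_of_nonneg (by linarith), le_div_iff₀ hN']
    set r := i / (N - i)
    have h7 : (t - r) * (N - i) ≤ 1 + t := by linarith
    have h8 : (N : ℝ) ≤ (N - i) * (1 + t) := by linarith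
    calc (t - r) * N ≤ (t - r) * ((N - i) * (1 + t)) :=
          mul_le_mul_of_nonneg_left h8 (by linarith)
      _ = (t - r) * (N - i) * (1 + t) := by ring
      _ ≤ (1 + t) * (1 + t) := by gcongr
      _ = (1 + t) ^ 2 := by ring
  unfold compandingQuantizer
  split_ifs with h
  · rwa [abs_of_nonneg h] at key ⊢
  · rw [abs_of_neg (not_le.1 h)] at key ⊢
    rw [Real.norm_eq_abs, ← abs_neg]
    convert key using 2
    ring

theorem range_compandingQuantizer_subset {N : ℕ} (hN : 1 ≤ N) :
    Set.range (compandingQuantizer N) ⊆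
      (Finset.Ioo (-(N : ℤ)) N).image fun i : ℤ => (i : ℝ) / (N - |(i : ℝ)|) := by
  rintro _ ⟨z, rfl⟩
  have h := floor_mul_div_lt hN z
  rw [Finset.coe_image]
  unfold compandingQuantizer
  split_ifs with hz
  · refine ⟨(⌊N * (|z| / (1 + |z|))⌋₊ : ℤ), ?_, ?_⟩
    · simp only [Finset.coe_Ioo, Set.mem_Ioo]
      omega
    · simp
  · refine ⟨-(⌊N * (|z| / (1 + |z|))⌋₊ : ℤ), ?_, ?_⟩
    · simp only [Finset.coe_Ioo, Set.mem_Ioo]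
      omega
    · simp [neg_div]

theorem integrable_norm_sub_sq_of_finite_range {g : ℝ → ℝ} (hg : Measurable g)
    (hfin : (Set.range g).Finite) : Integrable (fun z => ‖z - g z‖ ^ 2) (gaussianReal 0 1) := by
  obtain ⟨C, hC⟩ := hfin.isBounded.exists_norm_le
  have h1 : MemLp g 2 (gaussianReal 0 1) :=
    MemLp.of_bound hg.aestronglyMeasurable C (Eventually.of_forall fun z => hC _ ⟨z, rfl⟩)
  have h2 : MemLp id 2 (gaussianReal 0 1) := memLp_id_gaussianReal 2
  have h3 := (h2.sub h1)
  exact (memLp_two_iff_integrable_sq_norm h3.1).1 h3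

/-- The quantization error of the standard normal distribution is of order at most `1 / k`, and
this order is attained by explicit quantizers. -/
theorem exists_quantizer_gaussianReal : ∃ C : ℝ, 0 ≤ C ∧ ∀ k : ℕ, 1 ≤ k →
    (∃ g : ℝ → ℝ, Measurable g ∧ (Set.range g).encard ≤ k ∧
      ∫ z, ‖z - g z‖ ^ 2 ∂(gaussianReal 0 1) ≤ C / (k : ℝ) ^ 2) ∧
    quantError (gaussianReal 0 1) k ^ 2 ≤ C / (k : ℝ) ^ 2 := by
  have hmom : Integrable (fun z : ℝ => (1 + |z|) ^ 4) (gaussianReal 0 1) := by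
    have h0 : MemLp (fun z : ℝ => |z|) (4 : ℕ) (gaussianReal 0 1) := by
      have h := (memLp_id_gaussianReal (μ := 0) (v := 1) ((4 : ℕ) : NNReal)).abs
      rwa [ENNReal.coe_natCast] at h
    have h1 : MemLp (fun _ : ℝ => (1 : ℝ)) (4 : ℕ) (gaussianReal 0 1) := memLp_const 1
    have h2 := (h1.add h0).integrable_norm_pow (by norm_num)
    refine h2.congr (Eventually.of_forall fun z => ?_)
    have : 0 ≤ 1 + |z| := by positivity
    simp [abs_of_nonneg this]
  refine ⟨4 * ∫ z : ℝ, (1 + |z|) ^ 4 ∂(gaussianReal 0 1), by positivity, fun k hk => ?_⟩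
  -- The two signs share the value 0, so a grid of size N uses at most 2N - 1 ≤ k values, while k ≤
  -- 2N accounts for the factor 4 in the constant.
  obtain ⟨N, hN1, hN2, hN3⟩ : ∃ N : ℕ, 1 ≤ N ∧ 2 * N - 1 ≤ k ∧ k ≤ 2 * N :=
    ⟨(k + 1) / 2, by omega, by omega, by omega⟩
  have hN' : (0 : ℝ) < N := by exact_mod_cast hN1
  have hk' : (0 : ℝ) < k := by exact_mod_cast hk
  have hkN : (k : ℝ) ≤ 2 * N := by exact_mod_cast hN3
  have hsub := range_compandingQuantizer_subset hN1
  have hcard : ((Finset.Ioo (-(N : ℤ)) N).image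
      fun i : ℤ => (i : ℝ) / (N - |(i : ℝ)|)).card ≤ k := by
    refine Finset.card_image_le.trans ?_
    rw [Int.card_Ioo]
    omega
  have hint := integrable_norm_sub_sq_of_finite_range (measurable_compandingQuantizer N)
    ((Finset.finite_toSet _).subset hsub)
  have hbound : ∫ z, ‖z - compandingQuantizer N z‖ ^ 2 ∂(gaussianReal 0 1) ≤
      (4 * ∫ z : ℝ, (1 + |z|) ^ 4 ∂(gaussianReal 0 1)) / (k : ℝ) ^ 2 := by
    calc _ ≤ ∫ z : ℝ, (1 + |z|) ^ 4 / (N : ℝ) ^ 2 ∂(gaussianReal 0 1) := by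
          refine integral_mono hint (hmom.div_const _) fun z => ?_
          calc _ ≤ ((1 + |z|) ^ 2 / N) ^ 2 := by
                gcongr
                exact norm_sub_compandingQuantizer_le hN1 z
            _ = _ := by ring
      _ = (∫ z : ℝ, (1 + |z|) ^ 4 ∂(gaussianReal 0 1)) / (N : ℝ) ^ 2 := integral_div _ _
      _ ≤ _ := by
          have : 0 ≤ ∫ z : ℝ, (1 + |z|) ^ 4 ∂(gaussianReal 0 1) := by positivity
          rw [div_le_div_iff₀ (by positivity) (by positivity)]
          have h2 : (k : ℝ) ^ 2 ≤ (2 * N) ^ 2 := by gcongr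
          nlinarith
  refine ⟨⟨compandingQuantizer N, measurable_compandingQuantizer N, ?_, hbound⟩, ?_⟩
  · refine (Set.encard_le_encard hsub).trans ?_
    rw [Set.encard_coe_eq_coe_finsetCard]
    exact_mod_cast hcard
  · refine le_trans ?_ hbound
    rw [← Real.le_sqrt (quantError_nonneg _ _) (by positivity)]
    exact quantError_le_of_range_subset hsub hcard hint

theorem integral_exp_sq_div_gaussianReal :
    ∫ z : ℝ, Real.exp (z ^ 2 / 4) ∂(gaussianReal 0 1) = √2 := by
  rw [integral_gaussianReal_eq_integral_smul one_ne_zero]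
  have : ∀ x : ℝ, gaussianPDFReal 0 1 x • Real.exp (x ^ 2 / 4) =
      (√(2 * Real.pi))⁻¹ * Real.exp (-(1 / 4) * x ^ 2) := by
    intro x
    rw [gaussianPDFReal, smul_eq_mul, mul_assoc, ← Real.exp_add]
    simp only [NNReal.coe_one, mul_one, sub_zero]
    congr 2
    ring
  simp_rw [this]
  rw [integral_const_mul, integral_gaussian, ← Real.sqrt_inv,
    ← Real.sqrt_mul (by positivity)]
  congr 1
  have := Real.pi_pos
  field_simp
  norm_num

theorem integrable_exp_sq_div_gaussianReal :
    Integrable (fun z : ℝ => Real.exp (z ^ 2 / 4)) (gaussianReal 0 1) :=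
  Integrable.of_integral_ne_zero (by rw [integral_exp_sq_div_gaussianReal]; positivity)

end StandardGaussian

/-! ### Gaussian measures on H in the eigenbasis. -/

section Hilbert

variable {H : Type*} [NormedAddCommGroup H] [InnerProductSpace ℝ H]

/-- The family is a Hilbert basis of its closed span only, so Parseval is applied inside that
subspace. -/
theorem Orthonormal.hasSum_inner_sq [CompleteSpace H] {u : ℕ → H} (hu : Orthonormal ℝ u) {x : H}
    (hx : x ∈ (Submodule.span ℝ (Set.range u)).topologicalClosure) :
    HasSum (fun j => ⟪x, u j⟫ ^ 2) (‖x‖ ^ 2) := by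
  set V := (Submodule.span ℝ (Set.range u)).topologicalClosure with hV
  have hmem : ∀ j, u j ∈ V := fun j =>
    Submodule.le_topologicalClosure _ (Submodule.subset_span ⟨j, rfl⟩)
  have : CompleteSpace V :=
    (Submodule.isClosed_topologicalClosure _).completeSpace_coe
  set v : ℕ → V := fun j => ⟨u j, hmem j⟩ with hv
  have hvo : Orthonormal ℝ v := by
    rw [orthonormal_iff_ite] at hu ⊢
    exact hu
  have hdense : ⊤ ≤ (Submodule.span ℝ (Set.range v)).topologicalClosure := by
    rintro ⟨y, hy⟩ -
    rw [← SetLike.mem_coe, Submodule.topologicalClosure_coe, closure_subtype]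
    have himage : ((↑) : V → H) '' (Submodule.span ℝ (Set.range v) : Set V) =
        (Submodule.span ℝ (Set.range u) : Set H) := by
      have h1 := Submodule.map_span V.subtype (Set.range v)
      rw [← Set.range_comp] at h1
      exact congrArg (fun W : Submodule ℝ H => (W : Set H)) h1
    rw [himage, ← Submodule.topologicalClosure_coe]
    exact hy
  have h := (HilbertBasis.mk hvo hdense).hasSum_inner_mul_inner ⟨x, hx⟩ ⟨x, hx⟩
  simp only [HilbertBasis.coe_mk] at h
  have e : ∀ j, ⟪(⟨x, hx⟩ : V), v j⟫ * ⟪v j, (⟨x, hx⟩ : V)⟫ = ⟪x, u j⟫ ^ 2 := by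
    intro j
    rw [sq, real_inner_comm (⟨x, hx⟩ : V) (v j)]
    rfl
  simp_rw [e] at h
  rw [real_inner_self_eq_norm_sq] at h
  exact h

theorem Orthonormal.norm_sub_sum_smul_sq {u : ℕ → H} (hu : Orthonormal ℝ u) (s : Finset ℕ)
    (c : ℕ → ℝ) (x : H) :
    ‖x - ∑ j ∈ s, c j • u j‖ ^ 2 =
      ‖x‖ ^ 2 - ∑ j ∈ s, ⟪x, u j⟫ ^ 2 + ∑ j ∈ s, (⟪x, u j⟫ - c j) ^ 2 := by
  have h1 : ‖∑ j ∈ s, c j • u j‖ ^ 2 = ∑ j ∈ s, c j ^ 2 := by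
    rw [← real_inner_self_eq_norm_sq, hu.inner_sum]
    exact Finset.sum_congr rfl fun j _ => by simp [sq]
  rw [norm_sub_sq_real, h1, inner_sum, Finset.mul_sum, sub_add, sub_add, ← Finset.sum_sub_distrib,
    ← Finset.sum_sub_distrib]
  congr 1
  refine Finset.sum_congr rfl fun j _ => ?_
  rw [real_inner_smul_right]
  ring

variable [CompleteSpace H] [SecondCountableTopology H] [MeasurableSpace H] [BorelSpace H]
  {P : Measure H} [IsGaussian P] {lam : ℕ → ℝ} {u : ℕ → H}

theorem integrable_inner_sq (b : H) : Integrable (fun x => ⟪b, x⟫ ^ 2) P :=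
  ((IsGaussian.memLp_two_id (μ := P)).const_inner b).integrable_sq

theorem integrable_norm_sq : Integrable (fun x => ‖x‖ ^ 2) P :=
  (memLp_two_iff_integrable_sq_norm aestronglyMeasurable_id).1 (IsGaussian.memLp_two_id (μ := P))

theorem integrable_norm_sub_sq (a : H) : Integrable (fun x => ‖x - a‖ ^ 2) P :=
  have h := (IsGaussian.memLp_two_id (μ := P)).sub (memLp_const a)
  (memLp_two_iff_integrable_sq_norm h.1).1 h

/-- Presenting the marginal as a scaled standard normal also covers the degenerate case of zero
variance. -/
theorem map_inner_eq_gaussianReal (h0 : ∫ x, x ∂P = 0) (b : H) :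
    P.map (fun x => ⟪b, x⟫) = (gaussianReal 0 1).map fun z => √(∫ x, ⟪b, x⟫ ^ 2 ∂P) * z := by
  have h1 := IsGaussian.map_eq_gaussianReal (μ := P) (innerSL ℝ b)
  have h2 : ∫ x, innerSL ℝ b x ∂P = 0 := by
    rw [IsGaussian.integral_dual, h0, map_zero]
  rw [h2, variance_of_integral_eq_zero (by fun_prop) h2] at h1
  rw [gaussianReal_map_const_mul, mul_zero, mul_one]
  simp only [innerSL_apply_apply] at h1
  have h3 : (fun x => ⟪b, x⟫) = ⇑(innerSL ℝ b) := by
    ext x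
    simp
  rw [h3, h1]
  congr 1
  have h4 : 0 ≤ ∫ x, ⟪b, x⟫ ^ 2 ∂P := integral_nonneg fun x => by positivity
  ext
  simp [Real.sq_sqrt h4, h4]

theorem exp_inner_sq_bound (h0 : ∫ x, x ∂P = 0) {b : H} {v : ℝ} (hv : 0 < v)
    (hb : ∫ x, ⟪b, x⟫ ^ 2 ∂P ≤ v) :
    Integrable (fun x => Real.exp (⟪b, x⟫ ^ 2 / (4 * v))) P ∧
      ∫ x, Real.exp (⟪b, x⟫ ^ 2 / (4 * v)) ∂P ≤ 2 := by
  have hmeas : Measurable fun y : ℝ => Real.exp (y ^ 2 / (4 * v)) := by fun_prop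
  have hmb : Measurable fun x : H => ⟪b, x⟫ := by fun_prop
  set w := ∫ x, ⟪b, x⟫ ^ 2 ∂P with hw
  have hw0 : 0 ≤ w := integral_nonneg fun x => by positivity
  have hle : ∀ z : ℝ, Real.exp ((√w * z) ^ 2 / (4 * v)) ≤ Real.exp (z ^ 2 / 4) := by
    intro z
    rw [Real.exp_le_exp, mul_pow, Real.sq_sqrt hw0, div_le_div_iff₀ (by positivity) (by norm_num)]
    nlinarith [mul_le_mul_of_nonneg_right hb (sq_nonneg z)]
  have hint : Integrable (fun z : ℝ => Real.exp ((√w * z) ^ 2 / (4 * v))) (gaussianReal 0 1) := by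
    refine integrable_exp_sq_div_gaussianReal.mono'
      (Measurable.aestronglyMeasurable (by fun_prop)) (Eventually.of_forall fun z => ?_)
    rw [Real.norm_of_nonneg (Real.exp_pos _).le]
    exact hle z
  have hmap := map_inner_eq_gaussianReal h0 b
  rw [← hw] at hmap
  have hms : Measurable fun z : ℝ => √w * z := by fun_prop
  constructor
  · have h1 : Integrable (fun y : ℝ => Real.exp (y ^ 2 / (4 * v))) (P.map fun x => ⟪b, x⟫) := by
      rw [hmap]
      exact (integrable_map_measure hmeas.aestronglyMeasurable hms.aemeasurable).2 hint
    exact (integrable_map_measure hmeas.aestronglyMeasurable hmb.aemeasurable).1 h1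
  · rw [← integral_map (φ := fun x => ⟪b, x⟫) hmb.aemeasurable
      (f := fun y : ℝ => Real.exp (y ^ 2 / (4 * v))) hmeas.aestronglyMeasurable, hmap,
      integral_map hms.aemeasurable hmeas.aestronglyMeasurable]
    refine (integral_mono hint integrable_exp_sq_div_gaussianReal hle).trans ?_
    rw [integral_exp_sq_div_gaussianReal, Real.sqrt_le_left (by norm_num)]
    norm_num

namespace IsCovarianceEigensystem

theorem integral_inner_sum_sq (h : IsCovarianceEigensystem P lam u) (s : Finset ℕ) (c : ℕ → ℝ) :
    ∫ x, ⟪∑ j ∈ s, c j • u j, x⟫ ^ 2 ∂P = ∑ j ∈ s, c j ^ 2 * lam j := by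
  have h1 := covarianceOperator_inner (IsGaussian.memLp_two_id (μ := P))
    (∑ j ∈ s, c j • u j) (∑ j ∈ s, c j • u j)
  simp_rw [sq]
  rw [← h1, map_sum]
  simp_rw [map_smul, h.eigenvector, smul_smul]
  rw [h.orthonormal.inner_sum]
  refine Finset.sum_congr rfl fun j _ => ?_
  simp
  ring

theorem integral_inner_sq (h : IsCovarianceEigensystem P lam u) (j : ℕ) :
    ∫ x, ⟪x, u j⟫ ^ 2 ∂P = lam j := by
  have := h.integral_inner_sum_sq {j} fun _ => 1
  simp only [Finset.sum_singleton, one_smul, one_pow, one_mul] at this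
  simp_rw [real_inner_comm (u j)]
  exact this

theorem integrable_coord_sq (j : ℕ) : Integrable (fun x => ⟪x, u j⟫ ^ 2) P := by
  simp_rw [real_inner_comm (u j)]
  exact integrable_inner_sq (u j)

/-- Bessel's inequality and the finite second moment of a Gaussian measure. -/
theorem summable (h : IsCovarianceEigensystem P lam u) : Summable lam := by
  refine summable_of_sum_range_le (c := ∫ x, ‖x‖ ^ 2 ∂P) (fun j => (h.pos j).le) fun n => ?_
  simp_rw [← h.integral_inner_sq]
  rw [← integral_finsetSum _ fun j _ => integrable_coord_sq j]
  refine integral_mono (integrable_finsetSum _ fun j _ => integrable_coord_sq j)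
    integrable_norm_sq fun x => ?_
  have := h.orthonormal.sum_inner_products_le x (s := Finset.range n)
  simpa [real_inner_comm] using this

theorem integral_norm_sq (h : IsCovarianceEigensystem P lam u) :
    ∫ x, ‖x‖ ^ 2 ∂P = ∑' j, lam j := by
  have h1 := hasSum_integral_of_summable_integral_norm (μ := P)
    (F := fun (j : ℕ) (x : H) => ⟪x, u j⟫ ^ 2) (fun j => integrable_coord_sq j) (by
      simp_rw [norm_pow, Real.norm_eq_abs, sq_abs, h.integral_inner_sq]
      exact h.summable)
  simp_rw [h.integral_inner_sq] at h1
  rw [h1.tsum_eq]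
  refine integral_congr_ae ?_
  -- Almost every x lies in the support, which is the closed span of the eigenvectors, so Parseval
  -- applies.
  filter_upwards [Measure.support_mem_ae (μ := P)] with x hx
  rw [← h.basis_support] at hx
  exact (h.orthonormal.hasSum_inner_sq hx).tsum_eq.symm

/-! ### Lower bound for an arbitrary codebook. -/

/-- With q the squared length of the block projection of a and y = ⟨b, x⟩, the bound is -2 √q y + q
≥ -y². The resulting direction b depends on a but not on x. -/
theorem exists_direction (h : IsCovarianceEigensystem P lam u) (K M : ℕ) (a : H) :
    ∃ b : H, ∫ x, ⟪b, x⟫ ^ 2 ∂P ≤ lam K ∧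
      ∀ x, ∑ j ∈ Finset.Ico K M, ⟪x, u j⟫ ^ 2 - ⟪b, x⟫ ^ 2 ≤ ‖x - a‖ ^ 2 := by
  set c : ℕ → ℝ := fun j => ⟪a, u j⟫ with hc
  set q := ∑ j ∈ Finset.Ico K M, c j ^ 2 with hq
  have hq0 : 0 ≤ q := Finset.sum_nonneg fun j _ => sq_nonneg _
  have hsq := Real.sq_sqrt hq0
  -- The normalized projection of a onto the block; it is 0 when the projection vanishes, since then
  -- `(√q)⁻¹ = 0`.
  refine ⟨∑ j ∈ Finset.Ico K M, ((√q)⁻¹ * c j) • u j, ?_, fun x => ?_⟩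
  · rw [h.integral_inner_sum_sq]
    calc ∑ j ∈ Finset.Ico K M, ((√q)⁻¹ * c j) ^ 2 * lam j
        ≤ ∑ j ∈ Finset.Ico K M, ((√q)⁻¹ * c j) ^ 2 * lam K := by
          refine Finset.sum_le_sum fun j hj => ?_
          have := h.antitone (Finset.mem_Ico.1 hj).1
          gcongr
      _ = (q⁻¹ * q) * lam K := by
          rw [← Finset.sum_mul]
          simp_rw [mul_pow]
          rw [← Finset.mul_sum, inv_pow, hsq]
      _ ≤ 1 * lam K := by
          have := h.pos K
          gcongr
          exact inv_mul_le_one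
      _ = lam K := one_mul _
  · have hbessel : ∑ j ∈ Finset.Ico K M, (⟪x, u j⟫ - c j) ^ 2 ≤ ‖x - a‖ ^ 2 := by
      have := h.orthonormal.sum_inner_products_le (x - a) (s := Finset.Ico K M)
      refine le_trans (le_of_eq (Finset.sum_congr rfl fun j _ => ?_)) this
      rw [Real.norm_eq_abs, sq_abs, real_inner_comm (x - a), inner_sub_left]
    refine le_trans ?_ hbessel
    have hb : √q * ⟪∑ j ∈ Finset.Ico K M, ((√q)⁻¹ * c j) • u j, x⟫ =
        ∑ j ∈ Finset.Ico K M, ⟪x, u j⟫ * c j := by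
      rw [sum_inner, Finset.mul_sum]
      refine Finset.sum_congr rfl fun j hj => ?_
      rw [real_inner_smul_left, real_inner_comm]
      rcases eq_or_ne (√q) 0 with h1 | h1
      · have h2 : q = 0 := by rw [← hsq, h1]; simp
        have h3 : c j = 0 := by
          have := (Finset.sum_eq_zero_iff_of_nonneg fun j _ => sq_nonneg (c j)).1 h2 j hj
          exact pow_eq_zero_iff two_ne_zero |>.1 this
        simp [h3]
      · field_simp
    set y := ⟪∑ j ∈ Finset.Ico K M, ((√q)⁻¹ * c j) • u j, x⟫
    have hexp : ∑ j ∈ Finset.Ico K M, (⟪x, u j⟫ - c j) ^ 2 =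
        ∑ j ∈ Finset.Ico K M, ⟪x, u j⟫ ^ 2 - 2 * (√q * y) + √q ^ 2 := by
      rw [hb, hsq, hq, Finset.mul_sum, ← Finset.sum_sub_distrib, ← Finset.sum_add_distrib]
      exact Finset.sum_congr rfl fun j _ => by ring
    rw [hexp]
    nlinarith [sq_nonneg (√q - y)]

/-- The maximum over the codebook is bounded through t ≤ log n + exp(t)/n with t = ⟨b_a, x⟩²/(4
λ_K): the exponentials are summed over a, and each has expectation at most 2. -/
theorem sum_Ico_sub_le_integral_inf (h : IsCovarianceEigensystem P lam u) (h0 : ∫ x, x ∂P = 0)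
    (K M : ℕ) {n : ℕ} (hn : 1 ≤ n) (α : Finset H) (hα : α.Nonempty) (hcard : α.card ≤ n) :
    ∑ j ∈ Finset.Ico K M, lam j - 4 * lam K * (Real.log n + 2) ≤
      ∫ x, α.inf' hα (fun a => ‖x - a‖ ^ 2) ∂P := by
  choose b hb1 hb2 using h.exists_direction K M
  have hn' : (0 : ℝ) < n := by exact_mod_cast hn
  have hK := h.pos K
  set F : H → ℝ := fun x => ∑ j ∈ Finset.Ico K M, ⟪x, u j⟫ ^ 2 - 4 * lam K * (Real.log n +
    (n : ℝ)⁻¹ * ∑ a ∈ α, Real.exp (⟪b a, x⟫ ^ 2 / (4 * lam K))) with hF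
  have hint_coord : Integrable (fun x => ∑ j ∈ Finset.Ico K M, ⟪x, u j⟫ ^ 2) P :=
    integrable_finsetSum _ fun j _ => integrable_coord_sq j
  have hint_exp : Integrable (fun x => ∑ a ∈ α, Real.exp (⟪b a, x⟫ ^ 2 / (4 * lam K))) P :=
    integrable_finsetSum _ fun a _ => (exp_inner_sq_bound h0 hK (hb1 a)).1
  have hint_sum : Integrable (fun x => Real.log n +
      (n : ℝ)⁻¹ * ∑ a ∈ α, Real.exp (⟪b a, x⟫ ^ 2 / (4 * lam K))) P :=
    (integrable_const _).add (hint_exp.const_mul _)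
  have hFint : Integrable F P := hint_coord.sub (hint_sum.const_mul _)
  have hFval : ∑ j ∈ Finset.Ico K M, lam j - 4 * lam K * (Real.log n + 2) ≤ ∫ x, F x ∂P := by
    rw [hF, integral_sub hint_coord (hint_sum.const_mul _), integral_const_mul,
      integral_add (integrable_const _) (hint_exp.const_mul _), integral_const_mul,
      integral_finsetSum _ fun j _ => integrable_coord_sq j,
      integral_finsetSum _ fun a _ => (exp_inner_sq_bound h0 hK (hb1 a)).1]
    simp_rw [h.integral_inner_sq]
    have h1 : ∑ a ∈ α, ∫ x, Real.exp (⟪b a, x⟫ ^ 2 / (4 * lam K)) ∂P ≤ n * 2 := by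
      calc _ ≤ ∑ _a ∈ α, (2 : ℝ) :=
            Finset.sum_le_sum fun a _ => (exp_inner_sq_bound h0 hK (hb1 a)).2
        _ = α.card * 2 := by simp
        _ ≤ n * 2 := by gcongr
    have h2 : (n : ℝ)⁻¹ * ∑ a ∈ α, ∫ x, Real.exp (⟪b a, x⟫ ^ 2 / (4 * lam K)) ∂P ≤ 2 := by
      rw [inv_mul_le_iff₀ hn']
      exact h1
    have h3 : ∫ _x : H, Real.log n ∂P = Real.log n := by simp
    rw [h3]
    gcongr
  refine hFval.trans (integral_mono hFint ?_ fun x => ?_)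
  · obtain ⟨a, ha⟩ := id hα
    refine (integrable_norm_sub_sq (P := P) a).mono' (Continuous.aestronglyMeasurable ?_)
      (Eventually.of_forall fun x => ?_)
    · exact Continuous.finset_inf'_apply _ fun i _ => by fun_prop
    · rw [Real.norm_of_nonneg ((Finset.le_inf'_iff _ _).2 fun a _ => by positivity)]
      exact Finset.inf'_le _ ha
  · refine (Finset.le_inf'_iff _ _).2 fun a ha => le_trans ?_ (hb2 a x)
    simp only [hF]
    gcongr
    have h1 : Real.exp (⟪b a, x⟫ ^ 2 / (4 * lam K)) ≤
        ∑ a ∈ α, Real.exp (⟪b a, x⟫ ^ 2 / (4 * lam K)) :=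
      Finset.single_le_sum (f := fun a => Real.exp (⟪b a, x⟫ ^ 2 / (4 * lam K)))
        (fun a _ => (Real.exp_pos _).le) ha
    have h2 := Real.add_one_le_exp (⟪b a, x⟫ ^ 2 / (4 * lam K) - Real.log n)
    rw [Real.exp_sub, Real.exp_log hn', div_eq_inv_mul _ (n : ℝ)] at h2
    have h3 : ⟪b a, x⟫ ^ 2 / (4 * lam K) ≤ Real.log n +
        (n : ℝ)⁻¹ * ∑ a ∈ α, Real.exp (⟪b a, x⟫ ^ 2 / (4 * lam K)) := by
      have h4 := mul_le_mul_of_nonneg_left h1 (inv_pos.2 hn').le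
      linarith
    rw [div_le_iff₀' (by positivity)] at h3
    exact h3

theorem tsum_sub_le_quantError_sq (h : IsCovarianceEigensystem P lam u) (h0 : ∫ x, x ∂P = 0)
    (K : ℕ) {n : ℕ} (hn : 1 ≤ n) :
    ∑' j, lam (j + K) - 4 * lam K * (Real.log n + 2) ≤ quantError P n ^ 2 := by
  have hlim := (((summable_nat_add_iff K).2 h.summable).tendsto_sum_tsum_nat).sub_const
    (4 * lam K * (Real.log n + 2))
  refine le_of_tendsto hlim (Eventually.of_forall fun N => ?_)
  have h1 := le_quantError_sq (P := P) hn fun α hα hcard =>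
    h.sum_Ico_sub_le_integral_inf h0 K (K + N) hn α hα hcard
  rw [Finset.sum_Ico_eq_sum_range, Nat.add_sub_cancel_left] at h1
  simpa only [add_comm K] using h1

/-! ### Error and range of the scalar product quantizer. -/

section Product

variable {g : ℕ → ℝ → ℝ}

theorem integrable_and_integral_coord (h : IsCovarianceEigensystem P lam u)
    (h0 : ∫ x, x ∂P = 0) {g : ℝ → ℝ} (hg : Measurable g) (hfin : (Set.range g).Finite) (j : ℕ) :
    Integrable (fun x => (⟪x, u j⟫ - √(lam j) * g (⟪x, u j⟫ / √(lam j))) ^ 2) P ∧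
    ∫ x, (⟪x, u j⟫ - √(lam j) * g (⟪x, u j⟫ / √(lam j))) ^ 2 ∂P =
      lam j * ∫ z, ‖z - g z‖ ^ 2 ∂(gaussianReal 0 1) := by
  have hl := h.pos j
  have hs : 0 < √(lam j) := Real.sqrt_pos.2 hl
  have hmap : P.map (fun x => ⟪u j, x⟫) = (gaussianReal 0 1).map fun z => √(lam j) * z := by
    have h1 := map_inner_eq_gaussianReal h0 (u j)
    have h2 := h.integral_inner_sq j
    simp_rw [real_inner_comm (u j)] at h2
    rwa [h2] at h1
  simp_rw [real_inner_comm (u j)]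
  have hmeas : Measurable fun y : ℝ => (y - √(lam j) * g (y / √(lam j))) ^ 2 :=
    (measurable_id.sub ((hg.comp (measurable_id.div_const _)).const_mul _)).pow_const 2
  have hmb : Measurable fun x : H => ⟪u j, x⟫ := by fun_prop
  have hms : Measurable fun z : ℝ => √(lam j) * z := by fun_prop
  have hpt : ∀ z : ℝ, (√(lam j) * z - √(lam j) * g (√(lam j) * z / √(lam j))) ^ 2 =
      lam j * ‖z - g z‖ ^ 2 := by
    intro z
    rw [mul_div_cancel_left₀ _ hs.ne', ← mul_sub, mul_pow, Real.sq_sqrt hl.le, Real.norm_eq_abs,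
      sq_abs]
  constructor
  · have h1 : Integrable (fun y : ℝ => (y - √(lam j) * g (y / √(lam j))) ^ 2)
        (P.map fun x => ⟪u j, x⟫) := by
      rw [hmap, integrable_map_measure hmeas.aestronglyMeasurable hms.aemeasurable]
      refine ((integrable_norm_sub_sq_of_finite_range hg hfin).const_mul (lam j)).congr
        (Eventually.of_forall fun z => ?_)
      exact (hpt z).symm
    exact (integrable_map_measure hmeas.aestronglyMeasurable hmb.aemeasurable).1 h1
  · rw [← integral_map (φ := fun x => ⟪u j, x⟫) hmb.aemeasurable
      (f := fun y : ℝ => (y - √(lam j) * g (y / √(lam j))) ^ 2) hmeas.aestronglyMeasurable, hmap,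
      integral_map hms.aemeasurable hmeas.aestronglyMeasurable]
    simp_rw [hpt]
    rw [integral_const_mul]

theorem integrable_and_integral_scalarProductQuantizer (h : IsCovarianceEigensystem P lam u)
    (h0 : ∫ x, x ∂P = 0) {n : ℕ} (hg : ∀ j < productDim lam n, Measurable (g j))
    (hfin : ∀ j < productDim lam n, (Set.range (g j)).Finite) :
    Integrable (fun x => ‖x - scalarProductQuantizer lam u g n x‖ ^ 2) P ∧
    ∫ x, ‖x - scalarProductQuantizer lam u g n x‖ ^ 2 ∂P =
      ∑' j, lam (j + productDim lam n) +
      ∑ j ∈ Finset.range (productDim lam n), lam j * ∫ z, ‖z - g j z‖ ^ 2 ∂(gaussianReal 0 1) := by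
  have hcoord := fun j (hj : j ∈ Finset.range (productDim lam n)) =>
    h.integrable_and_integral_coord h0 (hg j (Finset.mem_range.1 hj))
      (hfin j (Finset.mem_range.1 hj)) j
  have hpt : ∀ x, ‖x - scalarProductQuantizer lam u g n x‖ ^ 2 =
      ‖x‖ ^ 2 - ∑ j ∈ Finset.range (productDim lam n), ⟪x, u j⟫ ^ 2 +
      ∑ j ∈ Finset.range (productDim lam n),
        (⟪x, u j⟫ - √(lam j) * g j (⟪x, u j⟫ / √(lam j))) ^ 2 := fun x =>
    h.orthonormal.norm_sub_sum_smul_sq _ (fun j => √(lam j) * g j (⟪x, u j⟫ / √(lam j))) x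
  simp_rw [hpt]
  have hi1 : Integrable (fun x => ∑ j ∈ Finset.range (productDim lam n), ⟪x, u j⟫ ^ 2) P :=
    integrable_finsetSum _ fun j _ => integrable_coord_sq j
  have hi2 : Integrable (fun x => ‖x‖ ^ 2 -
      ∑ j ∈ Finset.range (productDim lam n), ⟪x, u j⟫ ^ 2) P := integrable_norm_sq.sub hi1
  have hi3 : Integrable (fun x => ∑ j ∈ Finset.range (productDim lam n),
      (⟪x, u j⟫ - √(lam j) * g j (⟪x, u j⟫ / √(lam j))) ^ 2) P :=
    integrable_finsetSum _ fun j hj => (hcoord j hj).1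
  refine ⟨hi2.add hi3, ?_⟩
  rw [integral_add hi2 hi3, integral_sub integrable_norm_sq hi1, h.integral_norm_sq,
    integral_finsetSum _ fun j _ => integrable_coord_sq j,
    integral_finsetSum _ fun j hj => (hcoord j hj).1]
  simp_rw [h.integral_inner_sq]
  rw [← h.summable.sum_add_tsum_nat_add (productDim lam n), add_sub_cancel_left]
  congr 1
  exact Finset.sum_congr rfl fun j hj => (hcoord j hj).2

end Product

end IsCovarianceEigensystem

theorem range_scalarProductQuantizer_subset {H : Type*} [NormedAddCommGroup H]
    [InnerProductSpace ℝ H] {lam : ℕ → ℝ} {u : ℕ → H} {g : ℕ → ℝ → ℝ} {n N : ℕ} {r : ℕ → ℕ}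
    (hg : ∀ j < productDim lam n, (Set.range (g j)).encard ≤ r j)
    (hr : ∏ j ∈ Finset.range (productDim lam n), r j ≤ N) :
    ∃ α : Finset H, Set.range (scalarProductQuantizer lam u g n) ⊆ α ∧ α.card ≤ N := by
  classical
  have hR : ∀ j : Fin (productDim lam n), ∃ R : Finset ℝ, Set.range (g j) ⊆ R ∧ R.card ≤ r j := by
    intro j
    obtain ⟨h1, h2⟩ := Set.encard_le_coe_iff_finite_ncard_le.1 (hg j j.2)
    refine ⟨h1.toFinset, by simp, ?_⟩
    rwa [← Set.ncard_eq_toFinset_card _ h1]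
  choose R hR1 hR2 using hR
  refine ⟨(Fintype.piFinset R).image fun p => ∑ j : Fin (productDim lam n), (√(lam j) * p j) • u j, ?_, ?_⟩
  · rintro _ ⟨x, rfl⟩
    rw [Finset.coe_image]
    refine ⟨fun j => g j (⟪x, u j⟫ / √(lam j)), ?_, ?_⟩
    · simp only [Finset.mem_coe, Fintype.mem_piFinset]
      exact fun j => hR1 j ⟨_, rfl⟩
    · rw [scalarProductQuantizer, Finset.sum_range]
  · refine Finset.card_image_le.trans ?_
    rw [Fintype.card_piFinset]
    refine le_trans ?_ hr
    rw [Finset.prod_range]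
    exact Finset.prod_le_prod' fun j _ => hR2 j

end Hilbert

theorem isEquivalent_sqrt_of_tendsto_div {a b : ℕ → ℝ} (hb : ∀ᶠ n in atTop, 0 < b n)
    (h : Tendsto (fun n => a n / b n) atTop (𝓝 1)) :
    (fun n => √(a n)) ~[atTop] fun n => √(b n) := by
  rw [isEquivalent_iff_tendsto_one]
  · have h1 := h.sqrt
    rw [Real.sqrt_one] at h1
    refine h1.congr' ?_
    filter_upwards [hb] with n hn
    rw [Pi.div_apply, Real.sqrt_div' _ hn.le]
  · filter_upwards [hb] with n hn
    exact (Real.sqrt_pos.2 hn).ne'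

/-! ### Matching the two bounds. -/

section Asymptotics

variable {H : Type*} [NormedAddCommGroup H] [InnerProductSpace ℝ H] [CompleteSpace H]
  [SecondCountableTopology H] [MeasurableSpace H] [BorelSpace H]
  {P : Measure H} [IsGaussian P] {lam : ℕ → ℝ} {u : ℕ → H} {φ : ℝ → ℝ} {s : ℝ}

theorem tendsto_floor_log_div_log :
    Tendsto (fun n : ℕ => (⌊Real.log n⌋₊ : ℝ) / Real.log n) atTop (𝓝 1) :=
  (tendsto_nat_floor_div_atTop (R := ℝ)).comp
    (Real.tendsto_log_atTop.comp tendsto_natCast_atTop_atTop)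

/-- Only distortion of order 1/n_j² is required of the scalar quantizers, not optimality, so the
companding quantizers qualify as well as the optimal ones. -/
theorem IsCovarianceEigensystem.quantError_sq_le_and_le (h : IsCovarianceEigensystem P lam u)
    (h0 : ∫ x, x ∂P = 0)
    (hexc : Tendsto (fun k : ℕ => logExcess lam k / k) atTop (𝓝 1))
    {C : ℝ} (hC : 0 ≤ C) {g : ℕ → ℝ → ℝ} {n : ℕ} (hn : 1 ≤ n)
    (hmeas : ∀ j < productDim lam n, Measurable (g j))
    (hcard : ∀ j < productDim lam n, (Set.range (g j)).encard ≤ productLevel lam n j)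
    (herr : ∀ j < productDim lam n,
      ∫ z, ‖z - g j z‖ ^ 2 ∂(gaussianReal 0 1) ≤ C / (productLevel lam n j : ℝ) ^ 2) :
    Integrable (fun x => ‖x - scalarProductQuantizer lam u g n x‖ ^ 2) P ∧
    quantError P n ^ 2 ≤ ∫ x, ‖x - scalarProductQuantizer lam u g n x‖ ^ 2 ∂P ∧
    ∫ x, ‖x - scalarProductQuantizer lam u g n x‖ ^ 2 ∂P ≤
      ∑' j, lam (j + productDim lam n) +
        4 * C * (productDim lam n * lam (productDim lam n - 1)) := by
  have hm := (productDim_spec h.pos hexc hn).1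
  obtain ⟨hint, hval⟩ := h.integrable_and_integral_scalarProductQuantizer h0 hmeas
    fun j hj => (Set.encard_le_coe_iff_finite_ncard_le.1 (hcard j hj)).1
  refine ⟨hint, ?_, ?_⟩
  · obtain ⟨α, hα, hαcard⟩ := range_scalarProductQuantizer_subset (u := u) hcard
      (prod_productLevel_le h.pos hn hm)
    rw [← Real.le_sqrt (quantError_nonneg _ _) (by positivity)]
    exact quantError_le_of_range_subset hα hαcard hint
  · rw [hval]
    gcongr
    calc ∑ j ∈ Finset.range (productDim lam n), lam j * ∫ z, ‖z - g j z‖ ^ 2 ∂(gaussianReal 0 1)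
        ≤ ∑ _j ∈ Finset.range (productDim lam n), C * (4 * lam (productDim lam n - 1)) := by
          refine Finset.sum_le_sum fun j hj => ?_
          rw [Finset.mem_range] at hj
          have h1 := mul_le_mul_of_nonneg_left (herr j hj) (h.pos j).le
          have h2 := mul_le_mul_of_nonneg_left
            (eigenvalue_div_productLevel_sq_le h.pos h.antitone hexc hn hj).2 hC
          refine h1.trans (le_trans (le_of_eq ?_) h2)
          ring
      _ = _ := by
          rw [Finset.sum_const, Finset.card_range, nsmul_eq_mul]
          ring

/-- The squared quantization error and the squared error of scalar product quantizers built from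
quantizers of order-optimal distortion are both equivalent to the tail integral of `φ`. -/
theorem IsCovarianceEigensystem.tendsto_error_div (h : IsCovarianceEigensystem P lam u)
    (h0 : ∫ x, x ∂P = 0) (hφ : IsRegularlyVarying φ s (-1)) (ha : AntitoneOn φ (Set.Ioi s))
    (hlamφ : lam ~[atTop] fun j : ℕ => φ ((j : ℝ) + 1))
    {C : ℝ} (hC : 0 ≤ C) {g : ℕ → ℕ → ℝ → ℝ}
    (hmeas : ∀ n, 1 ≤ n → ∀ j < productDim lam n, Measurable (g n j))
    (hcard : ∀ n, 1 ≤ n → ∀ j < productDim lam n,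
      (Set.range (g n j)).encard ≤ productLevel lam n j)
    (herr : ∀ n, 1 ≤ n → ∀ j < productDim lam n,
      ∫ z, ‖z - g n j z‖ ^ 2 ∂(gaussianReal 0 1) ≤ C / (productLevel lam n j : ℝ) ^ 2) :
    Tendsto (fun n : ℕ => quantError P n ^ 2 / ∫ y in Set.Ioi (Real.log n), φ y) atTop (𝓝 1) ∧
    Tendsto (fun n : ℕ => (∫ x, ‖x - scalarProductQuantizer lam u (g n) n x‖ ^ 2 ∂P) /
      ∫ y in Set.Ioi (Real.log n), φ y) atTop (𝓝 1) := by
  have hexc := tendsto_logExcess_div hφ ha hlamφ h.pos h.antitone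
  have hlog : Tendsto (fun n : ℕ => Real.log (n : ℝ)) atTop atTop :=
    Real.tendsto_log_atTop.comp tendsto_natCast_atTop_atTop
  have hdim := tendsto_productDim_div_log h.pos hexc
  have hdim' : Tendsto (fun n : ℕ => ((productDim lam n - 1 : ℕ) : ℝ) / Real.log n) atTop
      (𝓝 2) := by
    have := hdim.sub hlog.inv_tendsto_atTop
    rw [sub_zero] at this
    refine this.congr' ?_
    filter_upwards [eventually_ge_atTop 1] with n hn
    rw [Nat.cast_pred (productDim_spec h.pos hexc hn).1, Pi.inv_apply]
    ring
  have hIpos : ∀ᶠ n : ℕ in atTop, 0 < ∫ y in Set.Ioi (Real.log n), φ y := by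
    filter_upwards [hlog.eventually_gt_atTop s] with n hn
    exact hφ.integral_pos ha
      (fun x hx => hφ.integrableOn_Ioi ha (hlamφ.summable_iff_nat.1 h.summable) hx) hn
  -- The cut-off K = ⌊log n⌋ balances the two terms: its tail sum is equivalent to the tail integral
  -- at log n, and the loss λ_K (log n + 2) is of smaller order.
  have hlow : Tendsto (fun n : ℕ => (∑' j, lam (j + ⌊Real.log n⌋₊) -
      4 * lam ⌊Real.log n⌋₊ * (Real.log n + 2)) / ∫ y in Set.Ioi (Real.log n), φ y)
      atTop (𝓝 1) := by
    have hy : Tendsto (fun n : ℕ => (Real.log n + 2) / Real.log n) atTop (𝓝 1) := by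
      have := tendsto_const_nhds (x := (1 : ℝ)).add (hlog.inv_tendsto_atTop.const_mul 2)
      rw [mul_zero, add_zero] at this
      refine this.congr' ?_
      filter_upwards [hlog.eventually_gt_atTop 0] with n hn
      rw [Pi.inv_apply]
      field_simp
    have h1 := tendsto_tsum_eigenvalue_div hφ ha hlamφ h.summable one_pos hlog
      tendsto_floor_log_div_log
    have h2 := tendsto_mul_eigenvalue_div hφ ha hlamφ h.summable one_pos hlog
      tendsto_floor_log_div_log hy
    have h3 := h1.sub (h2.const_mul 4)
    rw [mul_zero, sub_zero] at h3
    refine h3.congr fun n => ?_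
    ring
  -- The cut-off is now near 2 log n; slow variation removes the factor 2.
  have hup : Tendsto (fun n : ℕ => (∑' j, lam (j + productDim lam n) +
        4 * C * (productDim lam n * lam (productDim lam n - 1))) /
      ∫ y in Set.Ioi (Real.log n), φ y) atTop (𝓝 1) := by
    have h1 := tendsto_tsum_eigenvalue_div hφ ha hlamφ h.summable two_pos hlog hdim
    have h2 := tendsto_mul_eigenvalue_div hφ ha hlamφ h.summable two_pos hlog hdim' hdim
    have h3 := h1.add (h2.const_mul (4 * C))
    rw [mul_zero, add_zero] at h3
    refine h3.congr fun n => ?_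
    ring
  have hbounds := fun n (hn : 1 ≤ n) => h.quantError_sq_le_and_le h0 hexc hC hn
    (hmeas n hn) (hcard n hn) (herr n hn)
  constructor
  · refine tendsto_of_tendsto_of_tendsto_of_le_of_le' hlow hup ?_ ?_
    all_goals
      filter_upwards [eventually_ge_atTop 1, hIpos] with n hn hI
      gcongr
    · exact h.tsum_sub_le_quantError_sq h0 _ hn
    · exact (hbounds n hn).2.1.trans (hbounds n hn).2.2
  · refine tendsto_of_tendsto_of_tendsto_of_le_of_le' hlow hup ?_ ?_
    all_goals
      filter_upwards [eventually_ge_atTop 1, hIpos] with n hn hI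
      gcongr
    · exact (h.tsum_sub_le_quantError_sq h0 _ hn).trans (hbounds n hn).2.1
    · exact (hbounds n hn).2.2

end Asymptotics

theorem theorem2p1 {Ω H : Type*} [MeasurableSpace Ω] (μ : Measure Ω) [IsProbabilityMeasure μ]
    [NormedAddCommGroup H] [InnerProductSpace ℝ H] [CompleteSpace H] [SecondCountableTopology H]
    [MeasurableSpace H] [BorelSpace H]
    (X : Ω → H) (hX : HasGaussianLaw X μ) (hX0 : ∫ ω, X ω ∂μ = 0)
    (lam : ℕ → ℝ) (u : ℕ → H) (hlam : IsCovarianceEigensystem (μ.map X) lam u)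
    (s : ℝ) (hs : 0 ≤ s) (φ : ℝ → ℝ) (hφ : IsRegularlyVarying φ s (-1))
    (hφ_anti : AntitoneOn φ (Set.Ioi s))
    (hlamφ : lam ~[atTop] fun j : ℕ => φ ((j : ℝ) + 1)) :
    ((fun n : ℕ => quantError (μ.map X) n) ~[atTop]
        fun n : ℕ => invTail φ (Real.log n) ^ (-(1 / 2) : ℝ)) ∧
    ((fun n : ℕ => (productDim lam n : ℝ)) ~[atTop] fun n : ℕ => 2 * Real.log n) ∧
    ∀ g : ℕ → ℕ → ℝ → ℝ,
      (∀ n, 1 ≤ n → ∀ j < productDim lam n,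
        IsOptimalQuantizer (gaussianReal 0 1) (productLevel lam n j) (g n j)) →
      ((fun n : ℕ => quantError (μ.map X) n) ~[atTop]
        fun n : ℕ => √(∫ ω, ‖X ω - scalarProductQuantizer lam u (g n) n (X ω)‖ ^ 2 ∂μ)) ∧
      ((fun n : ℕ => √(∫ ω, ‖X ω - scalarProductQuantizer lam u (g n) n (X ω)‖ ^ 2 ∂μ)) ~[atTop]
        fun n : ℕ => invTail φ (Real.log n) ^ (-(1 / 2) : ℝ)) ∧
      Tendsto (fun n : ℕ => quantError (μ.map X) n ^ 2 /
          ∫ ω, ‖X ω - scalarProductQuantizer lam u (g n) n (X ω)‖ ^ 2 ∂μ) atTop (𝓝 1) := by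
  have hXm : AEMeasurable X μ := hX.aemeasurable
  have : IsGaussian (μ.map X) := hX.isGaussian_map
  have h0 : ∫ x, x ∂(μ.map X) = 0 := by
    exact (integral_map (f := fun x : H => x) hXm aestronglyMeasurable_id).trans hX0
  have hexc := tendsto_logExcess_div hφ hφ_anti hlamφ hlam.pos hlam.antitone
  have hlog : Tendsto (fun n : ℕ => Real.log (n : ℝ)) atTop atTop :=
    Real.tendsto_log_atTop.comp tendsto_natCast_atTop_atTop
  have hIpos : ∀ᶠ n : ℕ in atTop, 0 < ∫ y in Set.Ioi (Real.log n), φ y := by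
    filter_upwards [hlog.eventually_gt_atTop s] with n hn
    exact hφ.integral_pos hφ_anti (fun x hx =>
      hφ.integrableOn_Ioi hφ_anti (hlamφ.summable_iff_nat.1 hlam.summable) hx) hn
  have hψ : (fun n : ℕ => √(∫ y in Set.Ioi (Real.log n), φ y)) =ᶠ[atTop]
      fun n : ℕ => invTail φ (Real.log n) ^ (-(1 / 2) : ℝ) := by
    filter_upwards [hIpos] with n hn
    rw [invTail, one_div, Real.inv_rpow hn.le, Real.rpow_neg hn.le, inv_inv, Real.sqrt_eq_rpow]
  obtain ⟨C, hC, hquant⟩ := exists_quantizer_gaussianReal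
  have hmain : ∀ g : ℕ → ℕ → ℝ → ℝ,
      (∀ n, 1 ≤ n → ∀ j < productDim lam n, Measurable (g n j)) →
      (∀ n, 1 ≤ n → ∀ j < productDim lam n,
        (Set.range (g n j)).encard ≤ productLevel lam n j) →
      (∀ n, 1 ≤ n → ∀ j < productDim lam n,
        ∫ z, ‖z - g n j z‖ ^ 2 ∂(gaussianReal 0 1) ≤ C / (productLevel lam n j : ℝ) ^ 2) →
      ((fun n : ℕ => quantError (μ.map X) n) ~[atTop]
        fun n : ℕ => invTail φ (Real.log n) ^ (-(1 / 2) : ℝ)) ∧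
      ((fun n : ℕ => √(∫ ω, ‖X ω - scalarProductQuantizer lam u (g n) n (X ω)‖ ^ 2 ∂μ)) ~[atTop]
        fun n : ℕ => invTail φ (Real.log n) ^ (-(1 / 2) : ℝ)) ∧
      Tendsto (fun n : ℕ => quantError (μ.map X) n ^ 2 /
          ∫ ω, ‖X ω - scalarProductQuantizer lam u (g n) n (X ω)‖ ^ 2 ∂μ) atTop (𝓝 1) := by
    intro g h1 h2 h3
    obtain ⟨h4, h5⟩ := hlam.tendsto_error_div h0 hφ hφ_anti hlamφ hC h1 h2 h3
    have hmap : (fun n : ℕ => (∫ x, ‖x - scalarProductQuantizer lam u (g n) n x‖ ^ 2 ∂(μ.map X)) /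
          ∫ y in Set.Ioi (Real.log n), φ y) =ᶠ[atTop]
        fun n : ℕ => (∫ ω, ‖X ω - scalarProductQuantizer lam u (g n) n (X ω)‖ ^ 2 ∂μ) /
          ∫ y in Set.Ioi (Real.log n), φ y := by
      filter_upwards [eventually_ge_atTop 1] with n hn
      rw [integral_map hXm (hlam.quantError_sq_le_and_le h0 hexc hC hn (h1 n hn) (h2 n hn)
        (h3 n hn)).1.aestronglyMeasurable]
    have h6 := h5.congr' hmap
    refine ⟨?_, (isEquivalent_sqrt_of_tendsto_div hIpos h6).congr_right hψ, ?_⟩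
    · have h7 := (isEquivalent_sqrt_of_tendsto_div hIpos h4).congr_right hψ
      simp_rw [Real.sqrt_sq (quantError_nonneg _ _)] at h7
      exact h7
    · have h7 := h4.div h6 one_ne_zero
      rw [div_one] at h7
      refine h7.congr' ?_
      filter_upwards [hIpos] with n hn
      rw [Pi.div_apply, div_div_div_cancel_right₀ hn.ne']
  refine ⟨?_, ?_, fun g hg => ?_⟩
  -- The asymptotics of e_n involves no given quantizers, so explicit ones are inserted; existence
  -- of optimal quantizers is not needed.
  · have hex : ∀ n j, ∃ g : ℝ → ℝ, 1 ≤ n → j < productDim lam n → Measurable g ∧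
        (Set.range g).encard ≤ productLevel lam n j ∧
        ∫ z, ‖z - g z‖ ^ 2 ∂(gaussianReal 0 1) ≤ C / (productLevel lam n j : ℝ) ^ 2 := by
      intro n j
      by_cases hnj : 1 ≤ n ∧ j < productDim lam n
      · obtain ⟨g, hg⟩ := (hquant _ (eigenvalue_div_productLevel_sq_le hlam.pos hlam.antitone hexc
          hnj.1 hnj.2).1).1
        exact ⟨g, fun _ _ => hg⟩
      · exact ⟨0, fun h1 h2 => absurd ⟨h1, h2⟩ hnj⟩
    choose g hg using hex
    exact (hmain g (fun n hn j hj => (hg n j hn hj).1) (fun n hn j hj => (hg n j hn hj).2.1)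
      fun n hn j hj => (hg n j hn hj).2.2).1
  · have h1 := (tendsto_productDim_div_log hlam.pos hexc).mul_const 2⁻¹
    rw [mul_inv_cancel₀ two_ne_zero] at h1
    rw [isEquivalent_iff_tendsto_one]
    · refine h1.congr fun n => ?_
      rw [Pi.div_apply]
      ring
    · filter_upwards [hlog.eventually_gt_atTop 0] with n hn
      positivity
  · obtain ⟨h1, h2, h3⟩ := hmain g (fun n hn j hj => (hg n hn j hj).measurable)
      (fun n hn j hj => (hg n hn j hj).card_range_le) fun n hn j hj => by
        have hlevel := (eigenvalue_div_productLevel_sq_le hlam.pos hlam.antitone hexc hn hj).1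
        -- The distortion of an optimal quantizer is the squared quantization error, which the
        -- explicit quantizers bound by C/k².
        refine le_trans (le_of_eq ?_) (hquant _ hlevel).2
        rw [← (hg n hn j hj).error_eq, Real.sq_sqrt (by positivity)]
    exact ⟨h1.trans h2.symm, h2, h3⟩
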